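/- Let $d\ge 1$ and let $\mathcal F$ be a probability distribution on $\mathbb R^d$ with a density $f\ge 0$ such that $\sup_x f(x)\le F$ for some $F>0$ and $|f(x)-f(x')|\le L\|x-x'\|^{\alpha}$ for all $x,x'\in\mathbb R^d$, for some $L,\alpha>0$. Suppose that $\mathcal F$ is supported on a compact set. For $\lambda>0$ let $G(\lambda)$ be the set of connected components of the level set $\{x: f(x)\ge\lambda\}$, and suppose that $G(\lambda)$ is finite for every $\lambda>0$. Let $X_1,X_2,\dots$ be i.i.d. with law $\mathcal F$ and let $\mathbf X=\{X_1,\dots,X_n\}$. For $k=k(n)$ let $r_{k,n}(x)$ be the radius of the smallest closed ball centered at $x$ containing $k$ points of $\mathbf X\setminus\{x\}$, and let $f_n(x)=k/(n\cdot\mathrm{vol}\,B(x,r_{k,n}(x)))$. Fix $\theta>0$. In the $k$-NN graph (respectively the mutual $k$-NN graph) on the vertex set $\mathbf X$, two distinct points $X_i,X_j$ are adjacent iff $\|X_i-X_j\|\le\theta r_{k,n}(X_i)$ or (respectively and) $\|X_i-X_j\|\le\theta r_{k,n}(X_j)$. Let $G_n$ be either of these graphs. For $\lambda>0$ let $G_n(\lambda)$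 be the subgraph of $G_n$ induced on $\{X_i: f_n(X_i)\ge\lambda\}$. For a tuning parameter $\tilde\epsilon\ge 0$, let the pruned graph $\tilde G_n(\lambda)$ be obtained from $G_n(\lambda)$ as follows: if $\lambda>\tilde\epsilon$, join the components of $G_n(\lambda)$ that lie in the same component of $G_n(\lambda-\tilde\epsilon)$; if $\lambda\le\tilde\epsilon$, join all of $G_n(\lambda)$ into one component. The empirical clusters are the vertex sets of the components of the graphs $\tilde G_n(\lambda)$, $\lambda>0$. Assume that $\tilde\epsilon=\tilde\epsilon(n)\to0$ and $k(n)/\log n\to\infty$ as $n\to\infty$, and that for some constants $C,C',\delta>0$ and all sufficiently large $n$ $$C\left(\max\{1,\sqrt2/\theta\}\right)^d d\,\ln(n/\delta)\ \le\ k(n)\ \le\ C'\left(F\sqrt{\ln(n/\delta)}\right)^{2(\alpha+d)/(3\alpha+d)} n^{2\alpha/(3\alpha+d)} .$$ For $A\subset\mathbb R^d$ with $A\cap\mathbf X\neq\emptyset$ let $A_n$ denote the smallest empirical cluster containing $A\cap\mathbf X$. Then for every fixed $\lambda>0$, with probability tending to $1$ as $n\to\infty$, the cluster $A_n$ exists for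 every $A\in G(\lambda)$ with $A\cap\mathbf X\ne\emptyset$, and $A_n\cap A'_n=\emptyset$ for all distinct $A,A'\in G(\lambda)$ with $A\cap\mathbf X\neq\emptyset\neq A'\cap\mathbf X$. -/

import Mathlib

open MeasureTheory ProbabilityTheory Filter Topology

namespace KNNTree

noncomputable section

/-- The cluster tree at level `lam`: the connected components of the level set `{x | lam ≤ f x}`. -/
def clusterTree {d : ℕ} (f : EuclideanSpace ℝ (Fin d) → ℝ) (lam : ℝ) :
    Set (Set (EuclideanSpace ℝ (Fin d))) :=
  {A | ∃ x ∈ {y | lam ≤ f y}, A = connectedComponentIn {y | lam ≤ f y} x}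

/-- The distribution on `ℝ^d` with Lebesgue density `f`. -/
def distribution {d : ℕ} (f : EuclideanSpace ℝ (Fin d) → ℝ) :
    Measure (EuclideanSpace ℝ (Fin d)) :=
  volume.withDensity (fun x => ENNReal.ofReal (f x))

/-- The `n`-sample `{X_0, …, X_{n-1}}` as a set of points. -/
def sample {Ω : Type*} {d : ℕ} (X : ℕ → Ω → EuclideanSpace ℝ (Fin d)) (n : ℕ) (ω : Ω) :
    Set (EuclideanSpace ℝ (Fin d)) :=
  Set.range (fun i : Fin n => X i ω)

/-- The `k`-NN radius: the radius of the smallest closed ball centered at `x` that contains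
`k` points of `S \ {x}`. (If there are fewer than `k` such points, this is `0`, so that the
density estimate below is `0`, as it is for an infinite radius.) -/
def kNNRadius {d : ℕ} (S : Set (EuclideanSpace ℝ (Fin d))) (k : ℕ)
    (x : EuclideanSpace ℝ (Fin d)) : ℝ :=
  sInf {r : ℝ | 0 ≤ r ∧ k ≤ (Metric.closedBall x r ∩ (S \ {x})).ncard}

/-- The `k`-NN density estimate `f_n(x) = k / (n * vol B(x, r_{k,n}(x)))`. -/
def densityEstimate {d : ℕ} (S : Set (EuclideanSpace ℝ (Fin d))) (n k : ℕ)
    (x : EuclideanSpace ℝ (Fin d)) : ℝ :=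
  (k : ℝ) / ((n : ℝ) * volume.real (Metric.closedBall x (kNNRadius S k x)))

/-- The two graphs that are considered: the `k`-NN graph and the mutual `k`-NN graph. -/
inductive GraphKind
  | knn
  | mutualKnn

/-- The `k`-NN or mutual `k`-NN graph with parameter `θ` on the sample points. -/
def sampleGraph {d : ℕ} (kind : GraphKind) (S : Set (EuclideanSpace ℝ (Fin d))) (k : ℕ)
    (θ : ℝ) : SimpleGraph S where
  Adj u v := u ≠ v ∧
    match kind with
    | GraphKind.knn =>
        u.1 ∈ Metric.closedBall v.1 (θ * kNNRadius S k v.1) ∨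
          v.1 ∈ Metric.closedBall u.1 (θ * kNNRadius S k u.1)
    | GraphKind.mutualKnn =>
        u.1 ∈ Metric.closedBall v.1 (θ * kNNRadius S k v.1) ∧
          v.1 ∈ Metric.closedBall u.1 (θ * kNNRadius S k u.1)
  symm := ⟨by
    intro u v h
    cases kind
    · exact ⟨h.1.symm, h.2.symm⟩
    · exact ⟨h.1.symm, h.2.symm⟩⟩
  loopless := ⟨fun _ h => h.1 rfl⟩

/-- The vertices of the empirical tree at level `lam`. -/
def levelVertices {d : ℕ} (S : Set (EuclideanSpace ℝ (Fin d))) (n k : ℕ) (lam : ℝ) : Set S :=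
  {v | lam ≤ densityEstimate S n k v.1}

/-- `G_n(lam)`, the empirical tree at level `lam` before pruning: the subgraph of the
(mutual) `k`-NN graph induced on the sample points with `f_n ≥ lam`. -/
def levelGraph {d : ℕ} (kind : GraphKind) (S : Set (EuclideanSpace ℝ (Fin d))) (n k : ℕ)
    (θ lam : ℝ) : SimpleGraph (levelVertices S n k lam) :=
  (sampleGraph kind S k θ).induce (levelVertices S n k lam)

/-- The sample points `u` and `v` are vertices of the same component of `G_n(lam)`. -/
def SameComponent {d : ℕ} (kind : GraphKind) (S : Set (EuclideanSpace ℝ (Fin d))) (n k : ℕ)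
    (θ lam : ℝ) (u v : S) : Prop :=
  ∃ (hu : u ∈ levelVertices S n k lam) (hv : v ∈ levelVertices S n k lam),
    (levelGraph kind S n k θ lam).Reachable ⟨u, hu⟩ ⟨v, hv⟩

/-- The pruned graph at level `lam` with tuning parameter `ε`: if `ε < lam`, vertices of
`G_n(lam)` are connected when they are in the same component of `G_n(lam - ε)`; otherwise all
vertices of `G_n(lam)` are connected. -/
def prunedGraph {d : ℕ} (kind : GraphKind) (S : Set (EuclideanSpace ℝ (Fin d))) (n k : ℕ)
    (θ ε lam : ℝ) : SimpleGraph (levelVertices S n k lam) :=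
  levelGraph kind S n k θ lam ⊔
    SimpleGraph.fromRel (fun u v => ε < lam → SameComponent kind S n k θ (lam - ε) u.1 v.1)

/-- The empirical clusters: the vertex sets of the components of the pruned graphs, over all
levels `lam > 0`. -/
def clusters {d : ℕ} (kind : GraphKind) (S : Set (EuclideanSpace ℝ (Fin d))) (n k : ℕ)
    (θ ε : ℝ) : Set (Set (EuclideanSpace ℝ (Fin d))) :=
  {C | ∃ lam : ℝ, 0 < lam ∧ ∃ c : (prunedGraph kind S n k θ ε lam).ConnectedComponent,
    C = (fun v : levelVertices S n k lam => v.1.1) '' c.supp}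

/-- `C` is the smallest empirical cluster that contains the sample points in `A`. -/
def IsSmallestCluster {d : ℕ} (kind : GraphKind) (S : Set (EuclideanSpace ℝ (Fin d)))
    (n k : ℕ) (θ ε : ℝ) (A C : Set (EuclideanSpace ℝ (Fin d))) : Prop :=
  IsLeast {D | D ∈ clusters kind S n k θ ε ∧ A ∩ S ⊆ D} C

/-- The range of `k`:
`C max(1, √2/θ)^d d ln(n/δ) ≤ k ≤ C' (F √(ln(n/δ)))^(2(α+d)/(3α+d)) n^(2α/(3α+d))`. -/
def InRange (d : ℕ) (C C' F α θ δ : ℝ) (n k : ℕ) : Prop :=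
  C * (max 1 (√2 / θ)) ^ d * d * Real.log (n / δ) ≤ k ∧
    (k : ℝ) ≤ C' * (F * √(Real.log (n / δ))) ^ (2 * (α + d) / (3 * α + d)) *
      (n : ℝ) ^ (2 * α / (3 * α + d))

end

end KNNTree

namespace KNNTree

/-! Finitely many components make the separation quantitative. For some `η > 0`, distinct components
of `{f ≥ lam}` lie in distinct components of `{f ≥ lam - η}` (`exists_level_separation`), and the
latter are pairwise at distance at least some `δ > 0` (`exists_component_separation`).

Let `r(q)` be the radius for which `n * vol B(r(q)) * q = k`. Up to degenerate cases, `f_n(x) ≥ q`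
says that the ball of radius `r(q)` about `x` contains `k` other sample points. Since `k / n → 0`,
these radii vanish and `f` is nearly constant on such balls. A ball count then obeys a Chernoff
bound `exp(-c k)`, and `k / log n → ∞` pays for a union bound over a net of `O(n)` centers
(`tendsto_measure_of_net`). Hence, with probability tending to 1: points with `f ≥ lam - η/6` have
`f_n ≥ lam - η/3`; points with `f ≤ lam - η` have `f_n ≤ lam - 2η/3`; the relevant `k`-NN radii are
at least `r(2F)`; the sample is `(θ/3) r(2F)`-dense in `{f ≥ lam}`.

The rest is deterministic (`cluster_separation`). By density, the sample in a component `A` is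
connected in `G_n(lam - η/3)`. Pruning with `ε < η/3` only uses levels above `lam - 2η/3`, where
vertices have `f ≥ lam - η` and edges are shorter than `δ`. So the cluster of `A` at level `lam -
η/3` stays in one component of `{f ≥ lam - η}`, and the smallest cluster is inside it. -/

/-! ### Nets in bounded sets -/

/-- An `r`-separated finite set in a ball of radius `R` has at most `(2 (R + 1) / r) ^ d` points. -/
theorem card_mul_pow_le_of_separated {d : ℕ} {R r : ℝ} (hR : 0 ≤ R) (hr : 0 < r) (hr1 : r ≤ 1)
    (t : Finset (EuclideanSpace ℝ (Fin d))) (ht : ∀ x ∈ t, ‖x‖ ≤ R)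
    (hsep : ∀ x ∈ t, ∀ y ∈ t, x ≠ y → r < dist x y) :
    (t.card : ℝ) * r ^ d ≤ (2 * (R + 1)) ^ d := by
  set v := volume.real (Metric.ball (0 : EuclideanSpace ℝ (Fin d)) 1) with hv
  have hvpos : 0 < v := by
    rw [hv, measureReal_def]
    exact ENNReal.toReal_pos (Metric.measure_ball_pos _ _ one_pos).ne'
      (measure_ball_lt_top).ne
  have hvol : ∀ (x : EuclideanSpace ℝ (Fin d)) {s : ℝ}, 0 ≤ s →
      volume.real (Metric.closedBall x s) = s ^ d * v := by
    intro x s hs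
    rw [Measure.addHaar_real_closedBall _ _ hs]
    simp [hv]
  -- Volume comparison: the balls of radius `r / 2` are disjoint and, as `r ≤ 1`, lie in the ball of
  -- radius `R + 1`.
  have hU : volume.real (⋃ x ∈ t, Metric.closedBall x (r / 2)) =
      ∑ x ∈ t, volume.real (Metric.closedBall x (r / 2)) := by
    refine measureReal_biUnion_finset ?_ (fun x _ => measurableSet_closedBall)
      (fun x _ => measure_closedBall_lt_top.ne)
    intro x hx y hy hxy
    refine Metric.closedBall_disjoint_closedBall ?_
    have := hsep x hx y hy hxy
    linarith
  have hsub : (⋃ x ∈ t, Metric.closedBall x (r / 2)) ⊆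
      Metric.closedBall (0 : EuclideanSpace ℝ (Fin d)) (R + 1) := by
    refine Set.iUnion₂_subset fun x hx => Metric.closedBall_subset_closedBall' ?_
    rw [dist_zero_right]
    linarith [ht x hx]
  have hle := measureReal_mono (μ := volume) hsub measure_closedBall_lt_top.ne
  rw [hU, Finset.sum_congr rfl (fun x _ => hvol x (by positivity)), Finset.sum_const,
    nsmul_eq_mul, hvol _ (by positivity), ← mul_assoc] at hle
  have h2 := le_of_mul_le_mul_right hle hvpos
  rw [div_pow, mul_div_assoc', div_le_iff₀ (by positivity)] at h2
  rw [mul_pow, mul_comm ((2 : ℝ) ^ d)]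
  exact h2

/-- A bounded set has an `r`-net of size `O(r ^ (-d))`. -/
theorem exists_finset_net {d : ℕ} {R r : ℝ} (hR : 0 ≤ R) (hr : 0 < r) (hr1 : r ≤ 1)
    (E : Set (EuclideanSpace ℝ (Fin d))) (hE : ∀ x ∈ E, ‖x‖ ≤ R) :
    ∃ t : Finset (EuclideanSpace ℝ (Fin d)), (∀ x ∈ t, x ∈ E) ∧
      (t.card : ℝ) * r ^ d ≤ (2 * (R + 1)) ^ d ∧ ∀ x ∈ E, ∃ c ∈ t, dist x c ≤ r := by
  classical
  let Q : Finset (EuclideanSpace ℝ (Fin d)) → Prop := fun t =>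
    (∀ x ∈ t, x ∈ E) ∧ ∀ x ∈ t, ∀ y ∈ t, x ≠ y → r < dist x y
  have hbound : ∀ t, Q t → (t.card : ℝ) * r ^ d ≤ (2 * (R + 1)) ^ d := fun t ht =>
    card_mul_pow_le_of_separated hR hr hr1 t (fun x hx => hE x (ht.1 x hx)) ht.2
  let A : Set ℕ := {m | ∃ t, Q t ∧ t.card = m}
  have hne : A.Nonempty := ⟨0, ∅, ⟨by simp, by simp⟩, rfl⟩
  have hbdd : BddAbove A := by
    refine ⟨⌈(2 * (R + 1)) ^ d / r ^ d⌉₊, ?_⟩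
    rintro m ⟨t, ht, rfl⟩
    have : (t.card : ℝ) ≤ ⌈(2 * (R + 1)) ^ d / r ^ d⌉₊ :=
      ((le_div_iff₀ (by positivity)).2 (hbound t ht)).trans (Nat.le_ceil _)
    exact_mod_cast this
  -- A separated set of maximal cardinality is a net, since an uncovered point could be added to it.
  obtain ⟨t, ht, hcard⟩ := Nat.sSup_mem hne hbdd
  refine ⟨t, ht.1, hbound t ht, fun x hx => ?_⟩
  by_contra! hcon
  have hxt : x ∉ t := fun h => by
    have := hcon x h
    rw [dist_self] at this
    linarith
  have hQ : Q (insert x t) := by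
    refine ⟨fun y hy => ?_, fun y hy z hz hyz => ?_⟩
    · rcases Finset.mem_insert.1 hy with rfl | hy
      exacts [hx, ht.1 y hy]
    · rcases Finset.mem_insert.1 hy with hy' | hy' <;>
        rcases Finset.mem_insert.1 hz with hz' | hz'
      · exact absurd (hy'.trans hz'.symm) hyz
      · exact hy' ▸ hcon z hz'
      · rw [dist_comm, hz']; exact hcon y hy'
      · exact ht.2 y hy' z hz' hyz
  have := le_csSup hbdd ⟨_, hQ, rfl⟩
  rw [Finset.card_insert_of_notMem hxt, hcard] at this
  omega

/-! ### Chernoff bounds for the number of sample points in a set -/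

/-- The number of indices `i < n` with `X i ω ∈ B`. -/
noncomputable def hits {Ω E : Type*} (X : ℕ → Ω → E) (n : ℕ) (B : Set E) (ω : Ω) : ℕ :=
  {i | i < n ∧ X i ω ∈ B}.ncard

theorem hits_mono {Ω E : Type*} (X : ℕ → Ω → E) (n : ℕ) {B B' : Set E} (h : B ⊆ B') (ω : Ω) :
    hits X n B ω ≤ hits X n B' ω :=
  Set.ncard_le_ncard (fun _ hi => ⟨hi.1, h hi.2⟩) ((Set.finite_Iio n).subset fun _ hi => hi.1)

theorem hits_eq_sum {Ω E : Type*} (X : ℕ → Ω → E) (n : ℕ) (B : Set E) (ω : Ω) :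
    (hits X n B ω : ℝ) = (∑ i ∈ Finset.range n, fun ω => B.indicator (fun _ => (1 : ℝ)) (X i ω)) ω := by
  classical
  have : {i | i < n ∧ X i ω ∈ B} = ↑((Finset.range n).filter fun i => X i ω ∈ B) := by
    ext i; simp
  rw [hits, this, Set.ncard_coe_finset, Finset.sum_apply, Finset.card_filter]
  push_cast
  exact Finset.sum_congr rfl fun i _ => by simp [Set.indicator_apply]

section Chernoff

variable {Ω E : Type*} [MeasurableSpace Ω] [MeasurableSpace E] {P : Measure Ω}
  [IsProbabilityMeasure P] {X : ℕ → Ω → E} {ν : Measure E}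

/-- A Bernoulli variable has moment generating function `1 + p (e^t - 1)`; the Poisson bound `1 + x
≤ e^x` makes the product over the sample a single exponential. -/
theorem mgf_indicator_le (hX : ∀ i, Measurable (X i)) (hlaw : ∀ i, P.map (X i) = ν)
    {B : Set E} (hB : MeasurableSet B) (i : ℕ) (t : ℝ) :
    mgf (fun ω => B.indicator (fun _ => (1 : ℝ)) (X i ω)) P t ≤
      Real.exp (ν.real B * (Real.exp t - 1)) := by
  have h1 : ∀ ω, Real.exp (t * B.indicator (fun _ => (1 : ℝ)) (X i ω)) =
      1 + (X i ⁻¹' B).indicator (fun _ => Real.exp t - 1) ω := by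
    intro ω
    by_cases h : X i ω ∈ B <;> simp [h]
  have h2 : mgf (fun ω => B.indicator (fun _ => (1 : ℝ)) (X i ω)) P t =
      1 + ν.real B * (Real.exp t - 1) := by
    rw [mgf]
    simp_rw [h1]
    rw [integral_add (integrable_const _) ((integrable_const _).indicator (hX i hB)),
      integral_indicator_const _ (hX i hB), ← hlaw i, measureReal_def, measureReal_def,
      Measure.map_apply (hX i) hB]
    simp
  rw [h2, add_comm]
  exact Real.add_one_le_exp _

theorem mgf_hits_le (hX : ∀ i, Measurable (X i)) (hindep : iIndepFun X P)
    (hlaw : ∀ i, P.map (X i) = ν) {B : Set E} (hB : MeasurableSet B) (n : ℕ) (t : ℝ) :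
    mgf (fun ω => (hits X n B ω : ℝ)) P t ≤
      Real.exp (n * ν.real B * (Real.exp t - 1)) := by
  have hm : Measurable (B.indicator fun _ => (1 : ℝ)) := measurable_const.indicator hB
  have : (fun ω => (hits X n B ω : ℝ)) =
      ∑ i ∈ Finset.range n, fun ω => B.indicator (fun _ => (1 : ℝ)) (X i ω) :=
    funext fun ω => hits_eq_sum X n B ω
  have hsum := (hindep.comp (fun _ => B.indicator fun _ => (1 : ℝ)) fun _ => hm).mgf_sum (t := t)
    (fun i => hm.comp (hX i)) (Finset.range n)
  simp only [Function.comp_def] at hsum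
  rw [this, hsum]
  calc _ ≤ ∏ i ∈ Finset.range n, Real.exp (ν.real B * (Real.exp t - 1)) :=
        Finset.prod_le_prod (fun i _ => mgf_nonneg) fun i _ => mgf_indicator_le hX hlaw hB i t
    _ = _ := by rw [Finset.prod_const, Finset.card_range, ← Real.exp_nat_mul]; ring_nf

theorem integrable_exp_hits (hX : ∀ i, Measurable (X i)) {B : Set E} (hB : MeasurableSet B)
    (n : ℕ) (t : ℝ) : Integrable (fun ω => Real.exp (t * (hits X n B ω : ℝ))) P := by
  have hm : Measurable fun ω => (hits X n B ω : ℝ) := by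
    simp_rw [hits_eq_sum, Finset.sum_apply]
    exact Finset.measurable_sum _ fun i _ => (measurable_const.indicator hB).comp (hX i)
  refine Integrable.of_bound (hm.const_mul t).exp.aestronglyMeasurable (Real.exp (|t| * n))
    (ae_of_all _ fun ω => ?_)
  rw [Real.norm_eq_abs, Real.abs_exp, Real.exp_le_exp]
  have h : hits X n B ω ≤ n := by
    have := Set.ncard_le_ncard (s := {i | i < n ∧ X i ω ∈ B}) (t := Set.Iio n)
      (fun _ hi => hi.1) (Set.finite_Iio n)
    rwa [Set.ncard_Iio_nat] at this
  exact mul_le_mul (le_abs_self t) (by exact_mod_cast h) (by positivity) (abs_nonneg t)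

theorem measureReal_le_hits (hX : ∀ i, Measurable (X i)) (hindep : iIndepFun X P)
    (hlaw : ∀ i, P.map (X i) = ν) {B : Set E} (hB : MeasurableSet B) (n : ℕ) {t : ℝ} (ht : 0 ≤ t)
    (a : ℝ) : P.real {ω | a ≤ hits X n B ω} ≤
      Real.exp (n * ν.real B * (Real.exp t - 1) - t * a) := by
  refine (measure_ge_le_exp_mul_mgf a ht (integrable_exp_hits hX hB n t)).trans ?_
  refine (mul_le_mul_of_nonneg_left (mgf_hits_le hX hindep hlaw hB n t) (Real.exp_pos _).le).trans ?_
  rw [← Real.exp_add, Real.exp_le_exp]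
  linarith

theorem measureReal_hits_le (hX : ∀ i, Measurable (X i)) (hindep : iIndepFun X P)
    (hlaw : ∀ i, P.map (X i) = ν) {B : Set E} (hB : MeasurableSet B) (n : ℕ) {t : ℝ} (ht : 0 ≤ t)
    (a : ℝ) : P.real {ω | (hits X n B ω : ℝ) ≤ a} ≤
      Real.exp (n * ν.real B * (Real.exp (-t) - 1) + t * a) := by
  refine (measure_le_le_exp_mul_mgf a (neg_nonpos.2 ht) (integrable_exp_hits hX hB n _)).trans ?_
  refine (mul_le_mul_of_nonneg_left (mgf_hits_le hX hindep hlaw hB n _) (Real.exp_pos _).le).trans ?_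
  rw [← Real.exp_add, Real.exp_le_exp]
  linarith

end Chernoff

/-- For `γ < β`, the Chernoff exponent of the upper tail is negative for a suitable parameter. -/
theorem exists_exp_upper {γ β : ℝ} (hγ : 0 ≤ γ) (h : γ < β) :
    ∃ t, 0 ≤ t ∧ ∃ c, 0 < c ∧ γ * (Real.exp t - 1) - t * β ≤ -c := by
  -- Since `e^t - 1 ≤ t + t^2` on `[0, 1]`, the exponent is at most `-t (β - γ) + γ t^2`. This `t`
  -- gives `γ t^2 ≤ β t^2 = t (β - γ) / 2`, so half of the linear gain is left.
  set t := (β - γ) / (2 * β) with ht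
  have hβ : 0 < β := hγ.trans_lt h
  have ht0 : 0 < t := by have := sub_pos.2 h; positivity
  have ht1 : t ≤ 1 := by rw [ht, div_le_one (by positivity)]; linarith
  have hb : t * (2 * β) = β - γ := by rw [ht]; field_simp
  have hq : Real.exp t - 1 ≤ t + t ^ 2 := by
    have := abs_le.1 (Real.abs_exp_sub_one_sub_id_le (x := t) (by rw [abs_of_pos ht0]; exact ht1))
    linarith [this.2]
  refine ⟨t, ht0.le, t * (β - γ) / 2, by have := sub_pos.2 h; positivity, ?_⟩
  nlinarith [mul_le_mul_of_nonneg_left hq hγ, mul_pos ht0 ht0]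

/-- For `β < γ`, the Chernoff exponent of the lower tail is negative for a suitable parameter. -/
theorem exists_exp_lower {γ β : ℝ} (hβ : 0 ≤ β) (h : β < γ) :
    ∃ t, 0 ≤ t ∧ ∃ c, 0 < c ∧ γ * (Real.exp (-t) - 1) + t * β ≤ -c := by
  set t := (γ - β) / (2 * γ) with ht
  have hγ : 0 < γ := hβ.trans_lt h
  have ht0 : 0 < t := by have := sub_pos.2 h; positivity
  have ht1 : t ≤ 1 := by rw [ht, div_le_one (by positivity)]; linarith
  have hb : t * (2 * γ) = γ - β := by rw [ht]; field_simp
  have hq : Real.exp (-t) - 1 ≤ -t + t ^ 2 := by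
    have := abs_le.1 (Real.abs_exp_sub_one_sub_id_le (x := -t)
      (by rw [abs_neg, abs_of_pos ht0]; exact ht1))
    nlinarith [this.2]
  refine ⟨t, ht0.le, t * (γ - β) / 2, by have := sub_pos.2 h; positivity, ?_⟩
  nlinarith [mul_le_mul_of_nonneg_left hq hγ.le, mul_pos ht0 ht0]

/-! ### Volumes and masses of balls -/

/-- The volume of the unit ball. -/
noncomputable def unitVolume (d : ℕ) : ℝ :=
  volume.real (Metric.closedBall (0 : EuclideanSpace ℝ (Fin d)) 1)

theorem unitVolume_pos (d : ℕ) : 0 < unitVolume d := by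
  rw [unitVolume, measureReal_def]
  exact ENNReal.toReal_pos (Metric.measure_closedBall_pos _ _ one_pos).ne'
    (measure_closedBall_lt_top).ne

theorem volume_closedBall_eq {d : ℕ} (x : EuclideanSpace ℝ (Fin d)) {r : ℝ} (hr : 0 ≤ r) :
    volume.real (Metric.closedBall x r) = r ^ d * unitVolume d := by
  rw [Measure.addHaar_real_closedBall' _ _ hr, unitVolume]
  simp

section Mass

variable {d : ℕ} {f : EuclideanSpace ℝ (Fin d) → ℝ}

theorem distribution_closedBall_le
    {x : EuclideanSpace ℝ (Fin d)} {r m : ℝ} (hr : 0 ≤ r) (hm : 0 ≤ m)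
    (h : ∀ y ∈ Metric.closedBall x r, f y ≤ m) :
    (distribution f).real (Metric.closedBall x r) ≤ m * (r ^ d * unitVolume d) := by
  rw [← volume_closedBall_eq x hr, measureReal_def, measureReal_def, ← ENNReal.toReal_ofReal hm,
    ← ENNReal.toReal_mul]
  refine ENNReal.toReal_mono (ENNReal.mul_ne_top ENNReal.ofReal_ne_top
    measure_closedBall_lt_top.ne) ?_
  rw [distribution, withDensity_apply _ measurableSet_closedBall]
  calc _ ≤ ∫⁻ _ in Metric.closedBall x r, ENNReal.ofReal m :=
        setLIntegral_mono measurable_const fun y hy => ENNReal.ofReal_le_ofReal (h y hy)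
    _ = _ := by rw [setLIntegral_const]

theorem le_distribution_closedBall (hf : Measurable f) (hν : IsFiniteMeasure (distribution f))
    {x : EuclideanSpace ℝ (Fin d)} {r m : ℝ} (hr : 0 ≤ r) (hm : 0 ≤ m)
    (h : ∀ y ∈ Metric.closedBall x r, m ≤ f y) :
    m * (r ^ d * unitVolume d) ≤ (distribution f).real (Metric.closedBall x r) := by
  rw [← volume_closedBall_eq x hr, measureReal_def, measureReal_def, ← ENNReal.toReal_ofReal hm,
    ← ENNReal.toReal_mul]
  refine ENNReal.toReal_mono (measure_ne_top _ _) ?_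
  rw [distribution, withDensity_apply _ measurableSet_closedBall]
  calc _ = ∫⁻ _ in Metric.closedBall x r, ENNReal.ofReal m := by
        rw [setLIntegral_const]
    _ ≤ _ := setLIntegral_mono hf.ennreal_ofReal fun y hy => ENNReal.ofReal_le_ofReal (h y hy)

end Mass

section Growth

variable {k : ℕ → ℕ} (hk_lim : Tendsto (fun n : ℕ => (k n : ℝ) / Real.log n) atTop atTop)
include hk_lim

theorem eventually_pos_of_tendsto_div_log : ∀ᶠ n in atTop, 0 < k n := by
  filter_upwards [hk_lim.eventually_gt_atTop 0] with n hn
  by_contra h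
  rw [show k n = 0 by omega] at hn
  simp at hn

/-- As soon as `k ≥ (2 / c) log n`, the exponential is at most `n^(-2)`, which outweighs a union
bound over `O(n)` events. -/
theorem tendsto_mul_exp_neg {c : ℝ} (hc : 0 < c) :
    Tendsto (fun n : ℕ => (n : ℝ) * Real.exp (-(c * k n))) atTop (𝓝 0) := by
  have hlim : Tendsto (fun n : ℕ => ((n : ℝ))⁻¹) atTop (𝓝 0) := tendsto_inv_atTop_nhds_zero_nat
  refine squeeze_zero' (Eventually.of_forall fun n => by positivity) ?_ hlim
  filter_upwards [hk_lim.eventually_ge_atTop (2 / c), eventually_ge_atTop 2] with n hn h2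
  have hn2 : (2 : ℝ) ≤ n := by exact_mod_cast h2
  have hlog : 0 < Real.log n := Real.log_pos (by linarith)
  have h1 : 2 * Real.log n ≤ c * k n := by
    rw [div_le_div_iff₀ hc hlog] at hn
    linarith
  calc (n : ℝ) * Real.exp (-(c * k n)) ≤ n * Real.exp (-(2 * Real.log n)) := by gcongr
    _ = (n : ℝ)⁻¹ := by
      rw [Real.exp_neg, two_mul, Real.exp_add, Real.exp_log (by linarith)]
      field_simp

end Growth

/-! ### Uniform concentration over balls -/

section Uniform

variable {Ω : Type*} [MeasurableSpace Ω] {P : Measure Ω} [IsProbabilityMeasure P] {d : ℕ}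
  {k : ℕ → ℕ} {r : ℕ → ℝ} {q R : ℝ} {E : Set (EuclideanSpace ℝ (Fin d))}

/-- A union bound over a net: if locally, at scale `s * r n`, the events `bad n x` are
contained in events of exponentially small probability, then their union over a bounded set is
asymptotically negligible. -/
theorem tendsto_measure_of_net
    (hk_lim : Tendsto (fun n : ℕ => (k n : ℝ) / Real.log n) atTop atTop)
    (hR : 0 ≤ R) (hE : ∀ x ∈ E, ‖x‖ ≤ R)
    (hr0 : ∀ᶠ n in atTop, 0 < r n) (hr : Tendsto r atTop (𝓝 0))
    (hrk : ∀ᶠ n : ℕ in atTop, n * unitVolume d * r n ^ d * q = k n)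
    {s c : ℝ} (hs : 0 < s) (hc : 0 < c)
    (bad loc : ℕ → EuclideanSpace ℝ (Fin d) → Set Ω)
    (hsub : ∀ᶠ n in atTop, ∀ x ∈ E, ∀ y ∈ E, dist x y ≤ s * r n → bad n x ⊆ loc n y)
    (hloc : ∀ᶠ n in atTop, ∀ y ∈ E, P.real (loc n y) ≤ Real.exp (-(c * k n))) :
    Tendsto (fun n => P (⋃ x ∈ E, bad n x)) atTop (𝓝 0) := by
  rw [← ENNReal.tendsto_toReal_iff (fun n => measure_ne_top _ _) ENNReal.zero_ne_top,
    ENNReal.toReal_zero]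
  have hv := unitVolume_pos d
  -- A net at scale `s * r` has at most `(2 (R + 1))^d / (s r)^d` points, and `r^(-d) = n *
  -- unitVolume d * q / k` with `k ≥ 1`; so `M * n` bounds its size.
  set M := (2 * (R + 1)) ^ d * (unitVolume d * q / s ^ d) with hM
  have hlim := (tendsto_mul_exp_neg hk_lim hc).const_mul M
  rw [mul_zero] at hlim
  refine squeeze_zero' (Eventually.of_forall fun n => ENNReal.toReal_nonneg) ?_ hlim
  have hsr : ∀ᶠ n in atTop, s * r n < 1 := by
    have : Tendsto (fun n => s * r n) atTop (𝓝 0) := by simpa using hr.const_mul s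
    exact this.eventually_lt_const one_pos
  filter_upwards [hsub, hloc, hr0, hrk, hsr, eventually_pos_of_tendsto_div_log hk_lim]
    with n h1 h2 h3 h4 h5 h6
  obtain ⟨t, htE, hcard, hcov⟩ := exists_finset_net hR (mul_pos hs h3) h5.le E hE
  have hk1 : (1 : ℝ) ≤ k n := by exact_mod_cast h6
  have hcard' : (t.card : ℝ) ≤ M * n := by
    have h7 : (t.card : ℝ) * (s * r n) ^ d * k n ≤
        (2 * (R + 1)) ^ d * (n * unitVolume d * r n ^ d * q) := by
      rw [h4]; gcongr
    have h8 : (0 : ℝ) < r n ^ d := by positivity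
    have h9 : (0 : ℝ) < s ^ d := by positivity
    have h10 : (t.card : ℝ) * s ^ d * k n ≤ (2 * (R + 1)) ^ d * (n * unitVolume d * q) := by
      rw [mul_pow] at h7
      refine le_of_mul_le_mul_right ?_ h8
      linarith
    have h11 : (t.card : ℝ) * s ^ d ≤ (2 * (R + 1)) ^ d * (n * unitVolume d * q) :=
      (le_mul_of_one_le_right (by positivity) hk1).trans h10
    calc (t.card : ℝ) ≤ (2 * (R + 1)) ^ d * (n * unitVolume d * q) / s ^ d :=
          (le_div_iff₀ h9).2 h11
      _ = M * n := by rw [hM]; ring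
  calc P.real (⋃ x ∈ E, bad n x) ≤ P.real (⋃ y ∈ t, loc n y) := by
        refine measureReal_mono (Set.iUnion₂_subset fun x hx => ?_) (measure_ne_top _ _)
        obtain ⟨y, hy, hxy⟩ := hcov x hx
        exact (h1 x hx y (htE y hy) hxy).trans (Set.subset_biUnion_of_mem (u := loc n) hy)
    _ ≤ ∑ y ∈ t, P.real (loc n y) := measureReal_biUnion_finset_le _ _
    _ ≤ ∑ _y ∈ t, Real.exp (-(c * k n)) := Finset.sum_le_sum fun y hy => h2 y (htE y hy)
    _ = t.card * Real.exp (-(c * k n)) := by rw [Finset.sum_const, nsmul_eq_mul]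
    _ ≤ M * n * Real.exp (-(c * k n)) := by gcongr
    _ = M * (n * Real.exp (-(c * k n))) := by ring

variable {f : EuclideanSpace ℝ (Fin d) → ℝ} {L α : ℝ}
  {X : ℕ → Ω → EuclideanSpace ℝ (Fin d)}

theorem eventually_oscillation_le (hα : 0 < α)
    (hfα : ∀ x x', |f x - f x'| ≤ L * ‖x - x'‖ ^ α) (hL : 0 < L)
    (hr : Tendsto r atTop (𝓝 0)) {a s : ℝ} (hs : 0 < s) :
    ∀ᶠ n in atTop, ∀ x, ∀ y ∈ Metric.closedBall x (a * r n), |f y - f x| ≤ s := by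
  have h1 : Tendsto (fun n => L * |a * r n| ^ α) atTop (𝓝 0) := by
    have h2 : Tendsto (fun n => |a * r n|) atTop (𝓝 0) := by simpa using (hr.const_mul a).abs
    have h3 := (h2.rpow_const (p := α) (Or.inr hα.le)).const_mul L
    rwa [Real.zero_rpow hα.ne', mul_zero] at h3
  filter_upwards [h1.eventually_lt_const hs] with n hn x y hy
  refine (hfα y x).trans (le_trans ?_ hn.le)
  rw [Metric.mem_closedBall, dist_eq_norm] at hy
  have := hy.trans (le_abs_self _)
  gcongr

/-- Uniform upper bound for the number of sample points in balls. -/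
theorem tendsto_measure_le_hits
    (hk_lim : Tendsto (fun n : ℕ => (k n : ℝ) / Real.log n) atTop atTop)
    (hα : 0 < α) (hL : 0 < L) (hfα : ∀ x x', |f x - f x'| ≤ L * ‖x - x'‖ ^ α)
    (hX : ∀ i, Measurable (X i)) (hindep : iIndepFun X P)
    (hlaw : ∀ i, P.map (X i) = distribution f)
    (hR : 0 ≤ R) (hE : ∀ x ∈ E, ‖x‖ ≤ R) (hq : 0 < q)
    (hr0 : ∀ᶠ n in atTop, 0 < r n) (hr : Tendsto r atTop (𝓝 0))
    (hrk : ∀ᶠ n : ℕ in atTop, n * unitVolume d * r n ^ d * q = k n)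
    {m β : ℝ} (hm : 0 ≤ m) (hfm : ∀ x ∈ E, f x ≤ m) (hβ : m < β * q) :
    Tendsto (fun n => P {ω | ∃ x ∈ E, β * k n ≤ hits X n (Metric.closedBall x (r n)) ω})
      atTop (𝓝 0) := by
  have hν : IsProbabilityMeasure (distribution f) := by
    rw [← hlaw 0]; exact Measure.isProbabilityMeasure_map (hX 0).aemeasurable
  have hv := unitVolume_pos d
  -- The slack `s` pays for two losses: moving to a net point enlarges the radius by the factor `1 +
  -- s`, and the oscillation of `f` adds `s` to `m`. The expected count remains a fixed fraction
  -- below `β * k`.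
  obtain ⟨s, hs, hsβ⟩ : ∃ s : ℝ, 0 < s ∧ (m + s) * (1 + s) ^ d < β * q := by
    have hcont : Tendsto (fun s : ℝ => (m + s) * (1 + s) ^ d) (𝓝[>] 0) (𝓝 m) := by
      have : ContinuousAt (fun s : ℝ => (m + s) * (1 + s) ^ d) 0 := by fun_prop
      have h := this.tendsto
      simp only [add_zero, one_pow, mul_one] at h
      exact h.mono_left nhdsWithin_le_nhds
    obtain ⟨s, h1, h2⟩ := ((hcont.eventually_lt_const hβ).and self_mem_nhdsWithin).exists
    exact ⟨s, h2, h1⟩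
  obtain ⟨t, ht, c, hc, hexp⟩ := exists_exp_upper
    (γ := (m + s) * (1 + s) ^ d / q) (β := β) (by positivity) ((div_lt_iff₀ hq).2 hsβ)
  have key := tendsto_measure_of_net (P := P) (E := E) hk_lim hR hE hr0 hr hrk hs hc
    (fun n x => {ω | β * k n ≤ hits X n (Metric.closedBall x (r n)) ω})
    (fun n x => {ω | β * k n ≤ hits X n (Metric.closedBall x ((1 + s) * r n)) ω}) ?_ ?_
  · refine key.congr fun n => ?_
    congr 1
    ext ω
    simp
  · refine Eventually.of_forall fun n x _ y _ hxy ω hω => ?_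
    simp only [Set.mem_ofPred_eq] at hω ⊢
    refine hω.trans ?_
    exact_mod_cast hits_mono X n (Metric.closedBall_subset_closedBall' (by linarith)) ω
  · filter_upwards [eventually_oscillation_le hα hfα hL hr (a := 1 + s) hs, hr0, hrk]
      with n h1 h2 h3 y hy
    refine (measureReal_le_hits hX hindep hlaw measurableSet_closedBall n ht (β * k n)).trans ?_
    rw [Real.exp_le_exp]
    have hmass := distribution_closedBall_le (f := f) (x := y)
      (r := (1 + s) * r n) (m := m + s) (by positivity) (by positivity)
      fun z hz => by linarith [(abs_le.1 (h1 y z hz)).2, hfm y hy]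
    have h4 : n * (distribution f).real (Metric.closedBall y ((1 + s) * r n)) ≤
        (m + s) * (1 + s) ^ d / q * k n := by
      calc _ ≤ n * ((m + s) * (((1 + s) * r n) ^ d * unitVolume d)) := by gcongr
        _ = (m + s) * (1 + s) ^ d / q * k n := by
          rw [← h3, mul_pow]; field_simp
    have h5 : 0 ≤ Real.exp t - 1 := by linarith [Real.add_one_le_exp t]
    have h6 := mul_le_mul_of_nonneg_right h4 h5
    have h7 := mul_le_mul_of_nonneg_left hexp (Nat.cast_nonneg (α := ℝ) (k n))
    linarith

/-- Uniform lower bound for the number of sample points in balls. -/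
theorem tendsto_measure_hits_le
    (hk_lim : Tendsto (fun n : ℕ => (k n : ℝ) / Real.log n) atTop atTop)
    (hα : 0 < α) (hL : 0 < L) (hfα : ∀ x x', |f x - f x'| ≤ L * ‖x - x'‖ ^ α)
    (hfmeas : Measurable f)
    (hX : ∀ i, Measurable (X i)) (hindep : iIndepFun X P)
    (hlaw : ∀ i, P.map (X i) = distribution f)
    (hR : 0 ≤ R) (hE : ∀ x ∈ E, ‖x‖ ≤ R) (hq : 0 < q)
    (hr0 : ∀ᶠ n in atTop, 0 < r n) (hr : Tendsto r atTop (𝓝 0))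
    (hrk : ∀ᶠ n : ℕ in atTop, n * unitVolume d * r n ^ d * q = k n)
    {m β : ℝ} (hfm : ∀ x ∈ E, m ≤ f x) (hβ0 : 0 ≤ β) (hβ : β * q < m) :
    Tendsto (fun n => P {ω | ∃ x ∈ E, (hits X n (Metric.closedBall x (r n)) ω : ℝ) ≤ β * k n})
      atTop (𝓝 0) := by
  have hν : IsProbabilityMeasure (distribution f) := by
    rw [← hlaw 0]; exact Measure.isProbabilityMeasure_map (hX 0).aemeasurable
  have hv := unitVolume_pos d
  have hm : 0 < m := lt_of_le_of_lt (by positivity) hβ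
  -- Here the ball about the net point must shrink by the factor `1 - s` to fit into the original
  -- ball.
  obtain ⟨s, hs, hs1, hsm, hsβ⟩ :
      ∃ s : ℝ, 0 < s ∧ s < 1 ∧ s < m ∧ β * q < (m - s) * (1 - s) ^ d := by
    have hcont : Tendsto (fun s : ℝ => (m - s) * (1 - s) ^ d) (𝓝[>] 0) (𝓝 m) := by
      have : ContinuousAt (fun s : ℝ => (m - s) * (1 - s) ^ d) 0 := by fun_prop
      have h := this.tendsto
      simp only [sub_zero, one_pow, mul_one] at h
      exact h.mono_left nhdsWithin_le_nhds
    obtain ⟨s, h1, h2⟩ := ((hcont.eventually_const_lt hβ).and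
      (Ioo_mem_nhdsGT (lt_min one_pos hm))).exists
    exact ⟨s, h2.1, h2.2.trans_le (min_le_left _ _), h2.2.trans_le (min_le_right _ _), h1⟩
  obtain ⟨t, ht, c, hc, hexp⟩ := exists_exp_lower
    (γ := (m - s) * (1 - s) ^ d / q) (β := β) hβ0 ((lt_div_iff₀ hq).2 hsβ)
  have hs1' := sub_pos.2 hs1
  have hsm' := sub_pos.2 hsm
  have key := tendsto_measure_of_net (P := P) (E := E) hk_lim hR hE hr0 hr hrk hs hc
    (fun n x => {ω | (hits X n (Metric.closedBall x (r n)) ω : ℝ) ≤ β * k n})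
    (fun n x => {ω | (hits X n (Metric.closedBall x ((1 - s) * r n)) ω : ℝ) ≤ β * k n}) ?_ ?_
  · refine key.congr fun n => ?_
    congr 1
    ext ω
    simp
  · refine Eventually.of_forall fun n x _ y _ hxy ω hω => ?_
    simp only [Set.mem_ofPred_eq] at hω ⊢
    refine le_trans ?_ hω
    rw [dist_comm] at hxy
    exact_mod_cast hits_mono X n (Metric.closedBall_subset_closedBall' (by linarith)) ω
  · filter_upwards [eventually_oscillation_le hα hfα hL hr (a := 1 - s) hs, hr0, hrk]
      with n h1 h2 h3 y hy
    refine (measureReal_hits_le hX hindep hlaw measurableSet_closedBall n ht (β * k n)).trans ?_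
    rw [Real.exp_le_exp]
    have hmass := le_distribution_closedBall (f := f) hfmeas inferInstance (x := y)
      (r := (1 - s) * r n) (m := m - s) (by positivity) hsm'.le
      fun z hz => by linarith [(abs_le.1 (h1 y z hz)).1, hfm y hy]
    have h4 : (m - s) * (1 - s) ^ d / q * k n ≤
        n * (distribution f).real (Metric.closedBall y ((1 - s) * r n)) := by
      calc _ = n * ((m - s) * (((1 - s) * r n) ^ d * unitVolume d)) := by
            rw [← h3, mul_pow]; field_simp
        _ ≤ _ := by gcongr
    have h5 : 0 ≤ 1 - Real.exp (-t) := by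
      have : Real.exp (-t) ≤ 1 := Real.exp_le_one_iff.2 (by linarith)
      linarith
    have h6 := mul_le_mul_of_nonneg_right h4 h5
    have h7 := mul_le_mul_of_nonneg_left hexp (Nat.cast_nonneg (α := ℝ) (k n))
    linarith

end Uniform

/-! ### Separation of the components of level sets -/

section Levels

variable {E : Type*} [MetricSpace E] {f : E → ℝ} {K : Set E}

theorem isCompact_level (hf : Continuous f) (hK : IsCompact K) (hfK : ∀ x ∉ K, f x ≤ 0)
    {c : ℝ} (hc : 0 < c) : IsCompact {y | c ≤ f y} := by
  refine hK.of_isClosed_subset (isClosed_le continuous_const hf) fun y hy => ?_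
  by_contra h
  exact absurd (hc.trans_le (show c ≤ f y from hy)) (hfK y h).not_gt

/-- Points in different components of a level set are in different components of all slightly
larger level sets. -/
theorem eventually_notMem_component (hf : Continuous f) (hK : IsCompact K)
    (hfK : ∀ x ∉ K, f x ≤ 0) {lam : ℝ} (hlam : 0 < lam) {x x' : E} (hx : lam ≤ f x)
    (hx' : lam ≤ f x') (h : x' ∉ connectedComponentIn {y | lam ≤ f y} x) :
    ∀ᶠ η in 𝓝[>] (0 : ℝ), x' ∉ connectedComponentIn {y | lam - η ≤ f y} x := by
  have hD := isCompact_level hf hK hfK hlam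
  have : CompactSpace {y | lam ≤ f y} := isCompact_iff_compactSpace.1 hD
  have hx₁ : x ∈ {y | lam ≤ f y} := hx
  have hx'₁ : x' ∈ {y | lam ≤ f y} := hx'
  have hnot : (⟨x', hx'₁⟩ : {y | lam ≤ f y}) ∉ connectedComponent (⟨x, hx₁⟩ : {y | lam ≤ f y}) := by
    intro hmem
    apply h
    rw [connectedComponentIn_eq_image hx₁]
    exact ⟨_, hmem, rfl⟩
  -- In a compact Hausdorff space a component is the intersection of the clopen sets around it, so
  -- some clopen `Z` contains `x` but not `x'`; `Z` and its complement have disjoint open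
  -- neighborhoods `V`, `V'`.
  rw [connectedComponent_eq_iInter_isClopen, Set.mem_iInter, not_forall] at hnot
  obtain ⟨⟨Z, hZ, hxZ⟩, hx'Z⟩ := hnot
  have hU : IsCompact ((↑) '' Z : Set E) := hZ.isClosed.isCompact.image continuous_subtype_val
  have hW : IsCompact ((↑) '' Zᶜ : Set E) :=
    hZ.compl.isClosed.isCompact.image continuous_subtype_val
  have hdisj : Disjoint ((↑) '' Z : Set E) ((↑) '' Zᶜ : Set E) :=
    (Set.disjoint_image_iff Subtype.val_injective).2 disjoint_compl_right
  obtain ⟨V, V', hVo, hV'o, hUV, hWV', hVV'⟩ := SeparatedNhds.of_isCompact_isCompact hU hW hdisj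
  have hcover : {y | lam ≤ f y} ⊆ V ∪ V' := by
    intro y hy
    by_cases hyZ : (⟨y, hy⟩ : {y | lam ≤ f y}) ∈ Z
    · exact Or.inl (hUV ⟨_, hyZ, rfl⟩)
    · exact Or.inr (hWV' ⟨_, hyZ, rfl⟩)
  have hT : IsCompact ({y | lam / 2 ≤ f y} \ (V ∪ V')) :=
    (isCompact_level hf hK hfK (half_pos hlam)).diff (hVo.union hV'o)
  -- Outside `V ∪ V'` the compact set `{f ≥ lam / 2}` has maximum below `lam`, so slightly lower
  -- level sets are still inside `V ∪ V'`.
  obtain ⟨m, hm, hTm⟩ : ∃ m < lam, ∀ y ∈ {y | lam / 2 ≤ f y} \ (V ∪ V'), f y ≤ m := by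
    rcases Set.eq_empty_or_nonempty ({y | lam / 2 ≤ f y} \ (V ∪ V')) with h0 | h0
    · exact ⟨lam - 1, by linarith, by simp [h0]⟩
    · obtain ⟨z, hz, hmax⟩ := hT.exists_isMaxOn h0 hf.continuousOn
      refine ⟨f z, ?_, fun y hy => hmax hy⟩
      by_contra! hcon
      exact hz.2 (hcover hcon)
  filter_upwards [Ioo_mem_nhdsGT (show 0 < min (lam / 2) (lam - m) from
    lt_min (half_pos hlam) (sub_pos.2 hm))] with η hη hmem
  have h1 := hη.2.trans_le (min_le_left _ _)
  have h2 := hη.2.trans_le (min_le_right _ _)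
  have hsub : connectedComponentIn {y | lam - η ≤ f y} x ⊆ V ∪ V' := by
    intro y hy
    have hy' : y ∈ {y | lam - η ≤ f y} := connectedComponentIn_subset _ _ hy
    rw [Set.mem_ofPred_eq] at hy'
    by_contra hcon
    have := hTm y ⟨show lam / 2 ≤ f y by linarith, hcon⟩
    linarith
  have hxη : x ∈ connectedComponentIn {y | lam - η ≤ f y} x :=
    mem_connectedComponentIn (show lam - η ≤ f x by linarith [hη.1])
  have hV := isPreconnected_connectedComponentIn.subset_left_of_subset_union hVo hV'o hVV' hsub
    ⟨x, hxη, hUV ⟨_, hxZ, rfl⟩⟩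
  exact Set.disjoint_left.1 hVV' (hV hmem) (hWV' ⟨_, hx'Z, rfl⟩)

/-- If a compact set has finitely many components, then points of
different components have a positive distance. -/
theorem exists_component_separation {D : Set E} (hD : IsCompact D)
    (hfin : {A | ∃ x ∈ D, A = connectedComponentIn D x}.Finite) :
    ∃ δ > 0, ∀ x ∈ D, ∀ y ∈ D, dist x y < δ →
      connectedComponentIn D x = connectedComponentIn D y := by
  have hcomp : ∀ x ∈ D, IsCompact (connectedComponentIn D x) := by
    intro x hx
    have : CompactSpace D := isCompact_iff_compactSpace.1 hD
    rw [connectedComponentIn_eq_image hx]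
    exact isClosed_connectedComponent.isCompact.image continuous_subtype_val
  -- For each pair all small `δ` work, so finitely many pairs share one `δ`.
  have hev : ∀ p ∈ {A | ∃ x ∈ D, A = connectedComponentIn D x} ×ˢ
      {A | ∃ x ∈ D, A = connectedComponentIn D x}, ∀ᶠ δ in 𝓝[>] (0 : ℝ),
      p.1 ≠ p.2 → ∀ x ∈ p.1, ∀ y ∈ p.2, δ ≤ dist x y := by
    rintro ⟨_, _⟩ ⟨⟨x, hx, rfl⟩, ⟨y, hy, rfl⟩⟩
    by_cases hne : connectedComponentIn D x = connectedComponentIn D y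
    · exact Eventually.of_forall fun δ h => absurd hne h
    have hdisj : Disjoint (connectedComponentIn D x) (connectedComponentIn D y) := by
      rw [Set.disjoint_left]
      intro z hz hz'
      exact hne ((connectedComponentIn_eq hz).trans (connectedComponentIn_eq hz').symm)
    obtain ⟨δ, hδ, hth⟩ := hdisj.exists_thickenings (hcomp x hx) (hcomp y hy).isClosed
    filter_upwards [Ioo_mem_nhdsGT hδ] with δ' hδ' _ z hz w hw
    by_contra! hcon
    refine Set.disjoint_left.1 hth (Metric.mem_thickening_iff.2 ⟨z, hz, ?_⟩)
      (Metric.self_subset_thickening hδ _ hw)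
    rw [dist_comm]
    exact hcon.trans hδ'.2
  obtain ⟨δ, h1, h2⟩ := (((hfin.prod hfin).eventually_all.2 hev).and self_mem_nhdsWithin).exists
  refine ⟨δ, h2, fun x hx y hy hxy => ?_⟩
  by_contra hne
  exact absurd hxy (h1 (_, _) ⟨⟨x, hx, rfl⟩, ⟨y, hy, rfl⟩⟩ hne x (mem_connectedComponentIn hx) y
    (mem_connectedComponentIn hy)).not_gt

/-- Distinct components of a level set with finitely many components stay in distinct components
of a slightly larger level set. -/
theorem exists_level_separation (hf : Continuous f) (hK : IsCompact K)
    (hfK : ∀ x ∉ K, f x ≤ 0) {lam : ℝ} (hlam : 0 < lam)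
    (hfin : {A | ∃ x ∈ {y | lam ≤ f y}, A = connectedComponentIn {y | lam ≤ f y} x}.Finite) :
    ∃ η, 0 < η ∧ η < lam ∧ ∀ x x', lam ≤ f x → lam ≤ f x' →
      connectedComponentIn {y | lam ≤ f y} x ≠ connectedComponentIn {y | lam ≤ f y} x' →
      connectedComponentIn {y | lam - η ≤ f y} x ≠ connectedComponentIn {y | lam - η ≤ f y} x' := by
  set T := {A | ∃ x ∈ {y | lam ≤ f y}, A = connectedComponentIn {y | lam ≤ f y} x} with hT
  have hev : ∀ p ∈ T ×ˢ T, ∀ᶠ η in 𝓝[>] (0 : ℝ), p.1 ≠ p.2 → ∀ x ∈ p.1, ∀ x' ∈ p.2,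
      connectedComponentIn {y | lam - η ≤ f y} x ≠
        connectedComponentIn {y | lam - η ≤ f y} x' := by
    rintro ⟨_, _⟩ ⟨⟨a, ha, rfl⟩, ⟨a', ha', rfl⟩⟩
    by_cases hne : connectedComponentIn {y | lam ≤ f y} a = connectedComponentIn {y | lam ≤ f y} a'
    · exact Eventually.of_forall fun δ h => absurd hne h
    have hnot : a' ∉ connectedComponentIn {y | lam ≤ f y} a :=
      fun h => hne (connectedComponentIn_eq h)
    -- One representative per component suffices: at the lower level, each point lies in the
    -- component of its representative.
    filter_upwards [eventually_notMem_component hf hK hfK hlam ha ha' hnot, self_mem_nhdsWithin]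
      with η hη hη0 _ x hx x' hx' heq
    have hsub : {y | lam ≤ f y} ⊆ {y | lam - η ≤ f y} := fun y (hy : lam ≤ f y) =>
      show lam - η ≤ f y by linarith [show 0 < η from hη0]
    have e1 := connectedComponentIn_eq (connectedComponentIn_mono a hsub hx)
    have e2 := connectedComponentIn_eq (connectedComponentIn_mono a' hsub hx')
    apply hη
    rw [e1, heq, ← e2]
    exact mem_connectedComponentIn (hsub ha')
  obtain ⟨η, h1, h2⟩ := (((hfin.prod hfin).eventually_all.2 hev).and (Ioo_mem_nhdsGT hlam)).exists
  exact ⟨η, h2.1, h2.2, fun x x' hx hx' hne => h1 (_, _) ⟨⟨x, hx, rfl⟩, ⟨x', hx', rfl⟩⟩ hne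
    x (mem_connectedComponentIn hx) x' (mem_connectedComponentIn hx')⟩

end Levels

section Regularity

variable {d : ℕ} {f : EuclideanSpace ℝ (Fin d) → ℝ}

theorem continuous_of_holder {L α : ℝ} (hα : 0 < α)
    (hfα : ∀ x x', |f x - f x'| ≤ L * ‖x - x'‖ ^ α) : Continuous f := by
  rw [continuous_iff_continuousAt]
  intro x
  rw [ContinuousAt, tendsto_iff_dist_tendsto_zero]
  have h1 : Tendsto (fun y => L * ‖y - x‖ ^ α) (𝓝 x) (𝓝 0) := by
    have h2 : Tendsto (fun y => ‖y - x‖) (𝓝 x) (𝓝 0) := by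
      have : Continuous fun y => ‖y - x‖ := by fun_prop
      simpa using this.tendsto x
    have h3 := (h2.rpow_const (p := α) (Or.inr hα.le)).const_mul L
    rwa [Real.zero_rpow hα.ne', mul_zero] at h3
  exact squeeze_zero (fun _ => dist_nonneg) (fun y => hfα y x) h1

/-- The set where `f > 0` outside `K` is open and Lebesgue-null, hence empty. This makes the level
sets at positive levels compact. -/
theorem nonpos_of_notMem_support (hf : Continuous f) {K : Set (EuclideanSpace ℝ (Fin d))}
    (hK : IsClosed K) (h0 : distribution f Kᶜ = 0) : ∀ x ∉ K, f x ≤ 0 := by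
  intro x hx
  by_contra! hpos
  have hopen : IsOpen (Kᶜ ∩ {y | 0 < f y}) :=
    hK.isOpen_compl.inter (isOpen_lt continuous_const hf)
  rw [distribution, withDensity_apply_eq_zero hf.measurable.ennreal_ofReal] at h0
  have h1 : volume (Kᶜ ∩ {y | 0 < f y}) = 0 := by
    refine measure_mono_null (fun y hy => ?_) h0
    exact ⟨by simpa using hy.2, hy.1⟩
  exact (hopen.measure_pos volume ⟨x, hx, hpos⟩).ne' h1

end Regularity

/-! ### Nearest-neighbor radii and the density estimate -/

section Radius

variable {d : ℕ} {S : Set (EuclideanSpace ℝ (Fin d))} {k n : ℕ} {x : EuclideanSpace ℝ (Fin d)}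
  {r q : ℝ}

theorem kNNRadius_nonneg : 0 ≤ kNNRadius S k x := Real.sInf_nonneg fun _ h => h.1

theorem kNNRadius_le (hr : 0 ≤ r) (h : k ≤ (Metric.closedBall x r ∩ (S \ {x})).ncard) :
    kNNRadius S k x ≤ r := csInf_le ⟨0, fun _ h => h.1⟩ ⟨hr, h⟩

theorem le_of_ncard_lt (hS : S.Finite) (h : (Metric.closedBall x r ∩ (S \ {x})).ncard < k)
    {s : ℝ} (hs : k ≤ (Metric.closedBall x s ∩ (S \ {x})).ncard) : r ≤ s := by
  by_contra! hlt
  have := Set.ncard_le_ncard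
    (Set.inter_subset_inter_left (S \ {x}) (Metric.closedBall_subset_closedBall (x := x) hlt.le))
    (hS.subset (Set.inter_subset_right.trans Set.sdiff_subset))
  omega

/-- The witness `s` shows that some radius is admissible; otherwise the infimum is `0` by
convention. -/
theorem le_kNNRadius (hS : S.Finite) (h : (Metric.closedBall x r ∩ (S \ {x})).ncard < k)
    {s : ℝ} (hs0 : 0 ≤ s) (hs : k ≤ (Metric.closedBall x s ∩ (S \ {x})).ncard) :
    r ≤ kNNRadius S k x :=
  le_csInf ⟨s, hs0, hs⟩ fun _ h' => le_of_ncard_lt hS h h'.2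

theorem densityEstimate_eq :
    densityEstimate S n k x = k / (n * (kNNRadius S k x ^ d * unitVolume d)) := by
  rw [densityEstimate, volume_closedBall_eq _ kNNRadius_nonneg]

/-- By `hr`, the estimate at radius `r` is `q`, and it decreases in the radius. Radius `0` has to be
excluded, because division by zero gives the estimate `0` when `d > 0`. -/
theorem le_densityEstimate (hr : n * unitVolume d * r ^ d * q = k) (hn : 0 < n) (hq : 0 ≤ q)
    (h0 : 0 < kNNRadius S k x) (h : kNNRadius S k x ≤ r) : q ≤ densityEstimate S n k x := by
  have hv := unitVolume_pos d
  have hn' : (0 : ℝ) < n := by exact_mod_cast hn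
  rw [densityEstimate_eq, le_div_iff₀ (by positivity), ← hr]
  have : kNNRadius S k x ^ d ≤ r ^ d := by gcongr
  calc q * (n * (kNNRadius S k x ^ d * unitVolume d)) ≤ q * (n * (r ^ d * unitVolume d)) := by
        gcongr
    _ = _ := by ring

theorem kNNRadius_le_of_lt_densityEstimate (hr : n * unitVolume d * r ^ d * q = k)
    (hr0 : 0 < r) (hn : 0 < n) (hq : 0 ≤ q) (h : q < densityEstimate S n k x) :
    kNNRadius S k x < r := by
  by_contra! hle
  have hv := unitVolume_pos d
  have hn' : (0 : ℝ) < n := by exact_mod_cast hn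
  have h0 := hr0.trans_le hle
  refine absurd h (not_lt.2 ?_)
  rw [densityEstimate_eq, div_le_iff₀ (by positivity), ← hr]
  calc _ = q * (n * (r ^ d * unitVolume d)) := by ring
    _ ≤ q * (n * (kNNRadius S k x ^ d * unitVolume d)) := by gcongr

theorem densityEstimate_le_of_ncard_lt (hd : 0 < d) (hS : S.Finite)
    (hr : n * unitVolume d * r ^ d * q = k)
    (hr0 : 0 < r) (hn : 0 < n) (hq : 0 ≤ q)
    (h : (Metric.closedBall x r ∩ (S \ {x})).ncard < k) : densityEstimate S n k x ≤ q := by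
  by_contra! hlt
  have h1 := kNNRadius_le_of_lt_densityEstimate hr hr0 hn hq hlt
  by_cases hne : ∃ s : ℝ, 0 ≤ s ∧ k ≤ (Metric.closedBall x s ∩ (S \ {x})).ncard
  · obtain ⟨s, hs0, hs⟩ := hne
    exact absurd h1 (le_kNNRadius hS h hs0 hs).not_gt
  -- With too few sample points both the radius and the estimate take the default value `0`.
  · have h2 : kNNRadius S k x = 0 := by
      have : {r : ℝ | 0 ≤ r ∧ k ≤ (Metric.closedBall x r ∩ (S \ {x})).ncard} = ∅ :=
        Set.eq_empty_iff_forall_notMem.2 fun s hs => hne ⟨s, hs⟩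
      rw [kNNRadius, this, Real.sInf_empty]
    rw [densityEstimate_eq, h2, zero_pow hd.ne'] at hlt
    simp at hlt
    linarith

end Radius

/-! ### Empirical clusters and the deterministic argument -/

section Graph

variable {d : ℕ} {kind : GraphKind} {S : Set (EuclideanSpace ℝ (Fin d))} {n k : ℕ} {θ : ℝ}

/-- Bounding the distance by both radii gives an edge in either kind of graph. -/
theorem sampleGraph_adj_of_dist_le {u v : S} (hne : u ≠ v)
    (hu : dist u.1 v.1 ≤ θ * kNNRadius S k u.1) (hv : dist u.1 v.1 ≤ θ * kNNRadius S k v.1) :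
    (sampleGraph kind S k θ).Adj u v := by
  refine ⟨hne, ?_⟩
  have h1 : u.1 ∈ Metric.closedBall v.1 (θ * kNNRadius S k v.1) := Metric.mem_closedBall.2 hv
  have h2 : v.1 ∈ Metric.closedBall u.1 (θ * kNNRadius S k u.1) :=
    Metric.mem_closedBall.2 (by rwa [dist_comm])
  cases kind
  · exact Or.inl h1
  · exact ⟨h1, h2⟩

theorem dist_lt_of_sampleGraph_adj {u v : S} (h : (sampleGraph kind S k θ).Adj u v) {δ : ℝ}
    (hu : θ * kNNRadius S k u.1 < δ) (hv : θ * kNNRadius S k v.1 < δ) : dist u.1 v.1 < δ := by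
  have h2 := h.2
  cases kind
  · rcases h2 with h2 | h2
    · exact (Metric.mem_closedBall.1 h2).trans_lt hv
    · rw [dist_comm]; exact (Metric.mem_closedBall.1 h2).trans_lt hu
  · exact (Metric.mem_closedBall.1 h2.1).trans_lt hv

theorem levelVertices_anti {c c' : ℝ} (h : c ≤ c') :
    levelVertices S n k c' ⊆ levelVertices S n k c := fun _ hv => h.trans hv

theorem SameComponent.refl {c : ℝ} {u : S} (hu : u ∈ levelVertices S n k c) :
    SameComponent kind S n k θ c u u := ⟨hu, hu, SimpleGraph.Reachable.refl _⟩

theorem SameComponent.symm {c : ℝ} {u v : S} (h : SameComponent kind S n k θ c u v) :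
    SameComponent kind S n k θ c v u := by
  obtain ⟨hu, hv, h⟩ := h
  exact ⟨hv, hu, h.symm⟩

theorem SameComponent.trans {c : ℝ} {u v w : S} (h : SameComponent kind S n k θ c u v)
    (h' : SameComponent kind S n k θ c v w) : SameComponent kind S n k θ c u w := by
  obtain ⟨hu, hv, h⟩ := h
  obtain ⟨_, hw, h'⟩ := h'
  exact ⟨hu, hw, h.trans h'⟩

theorem SameComponent.of_adj {c : ℝ} {u v : S} (hu : u ∈ levelVertices S n k c)
    (hv : v ∈ levelVertices S n k c) (h : (sampleGraph kind S k θ).Adj u v) :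
    SameComponent kind S n k θ c u v :=
  ⟨hu, hv, SimpleGraph.Adj.reachable (G := levelGraph kind S n k θ c) h⟩

/-- To show that a relation holds on the components of `G_n(c)`, it suffices to check edges. -/
theorem SameComponent.eq_of_adj {β : Type*} {c : ℝ} (g : S → β)
    (hg : ∀ u ∈ levelVertices S n k c, ∀ v ∈ levelVertices S n k c,
      (sampleGraph kind S k θ).Adj u v → g u = g v)
    {u v : S} (h : SameComponent kind S n k θ c u v) : g u = g v := by
  obtain ⟨hu, hv, ⟨p⟩⟩ := h
  have : ∀ (a b : levelVertices S n k c), (levelGraph kind S n k θ c).Walk a b → g a = g b := by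
    intro a b p
    induction p with
    | nil => rfl
    | cons h p ih => exact (hg _ (Subtype.property _) _ (Subtype.property _) h).trans ih
  exact this _ _ p

theorem SameComponent.anti {c c' : ℝ} (hc : c ≤ c') {u v : S}
    (h : SameComponent kind S n k θ c' u v) : SameComponent kind S n k θ c u v := by
  obtain ⟨hu, hv, h⟩ := h
  let φ : levelGraph kind S n k θ c' →g levelGraph kind S n k θ c :=
    ⟨fun v => ⟨v.1, levelVertices_anti hc v.2⟩, fun {a b} h =>
      show (sampleGraph kind S k θ).Adj a.1 b.1 from h⟩
  exact ⟨levelVertices_anti hc hu, levelVertices_anti hc hv, h.map φ⟩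

/-- The components of the pruned graph. -/
theorem prunedGraph_reachable_iff {ε c : ℝ} (hε : 0 ≤ ε) (u v : levelVertices S n k c) :
    (prunedGraph kind S n k θ ε c).Reachable u v ↔
      (ε < c → SameComponent kind S n k θ (c - ε) u.1 v.1) := by
  have hle : c - ε ≤ c := by linarith
  constructor
  · rintro ⟨p⟩ hc
    induction p with
    | @nil a => exact SameComponent.refl (levelVertices_anti hle a.2)
    | @cons a b _ h p ih =>
      refine SameComponent.trans ?_ ih
      rcases h with h | h
      · exact SameComponent.of_adj (levelVertices_anti hle a.2) (levelVertices_anti hle b.2) h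
      · rw [SimpleGraph.fromRel_adj] at h
        rcases h.2 with h2 | h2
        · exact h2 hc
        · exact (h2 hc).symm
  · intro h
    by_cases huv : u = v
    · rw [huv]
    -- Pruning adds an edge between every such pair, so one step suffices.
    · refine SimpleGraph.Adj.reachable ?_
      rw [prunedGraph, SimpleGraph.sup_adj, SimpleGraph.fromRel_adj]
      exact Or.inr ⟨huv, Or.inl h⟩

/-- A base vertex `u` replaces the quotient by reachability, so that later arguments only use
`SameComponent`. -/
theorem mem_clusters_iff {ε : ℝ} (hε : 0 ≤ ε) (C : Set (EuclideanSpace ℝ (Fin d))) :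
    C ∈ clusters kind S n k θ ε ↔ ∃ c : ℝ, 0 < c ∧ ∃ u ∈ levelVertices S n k c,
      C = Subtype.val '' {v : S | v ∈ levelVertices S n k c ∧
        (ε < c → SameComponent kind S n k θ (c - ε) v u)} := by
  have key : ∀ (c : ℝ) (u : levelVertices S n k c),
      (fun v : levelVertices S n k c => v.1.1) ''
        ((prunedGraph kind S n k θ ε c).connectedComponentMk u).supp =
      Subtype.val '' {v : S | v ∈ levelVertices S n k c ∧
        (ε < c → SameComponent kind S n k θ (c - ε) v u.1)} := by
    intro c u
    ext x
    simp only [Set.mem_image, SimpleGraph.ConnectedComponent.mem_supp_iff,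
      SimpleGraph.ConnectedComponent.eq, Set.mem_ofPred_eq]
    constructor
    · rintro ⟨v, hv, rfl⟩
      exact ⟨v.1, ⟨v.2, (prunedGraph_reachable_iff hε v u).1 hv⟩, rfl⟩
    · rintro ⟨v, ⟨hv, h⟩, rfl⟩
      exact ⟨⟨v, hv⟩, (prunedGraph_reachable_iff hε ⟨v, hv⟩ u).2 h, rfl⟩
  constructor
  · rintro ⟨c, hc, comp, rfl⟩
    induction comp using SimpleGraph.ConnectedComponent.ind with
    | h u => exact ⟨c, hc, u.1, u.2, key c u⟩
  · rintro ⟨c, hc, u, hu, rfl⟩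
    exact ⟨c, hc, _, (key c ⟨u, hu⟩).symm⟩

/-- The empirical clusters form a hierarchy. -/
theorem clusters_laminar {ε : ℝ} (hε : 0 ≤ ε) {D D' : Set (EuclideanSpace ℝ (Fin d))}
    (hD : D ∈ clusters kind S n k θ ε) (hD' : D' ∈ clusters kind S n k θ ε)
    (h : (D ∩ D').Nonempty) : D ⊆ D' ∨ D' ⊆ D := by
  rw [mem_clusters_iff hε] at hD hD'
  obtain ⟨c, -, u, -, rfl⟩ := hD
  obtain ⟨c', -, u', -, rfl⟩ := hD'
  obtain ⟨_, ⟨p, ⟨hp, hpu⟩, rfl⟩, ⟨p', ⟨hp', hpu'⟩, hpp⟩⟩ := h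
  obtain rfl : p' = p := Subtype.ext hpp
  -- The cluster from the higher level lies in the other one: its links survive at the lower level
  -- and pass through the common point `p'`.
  have key : ∀ {c c' : ℝ} {u u' : S}, c ≤ c' →
      (ε < c → SameComponent kind S n k θ (c - ε) p' u) →
      (ε < c' → SameComponent kind S n k θ (c' - ε) p' u') →
      Subtype.val '' {v : S | v ∈ levelVertices S n k c' ∧
        (ε < c' → SameComponent kind S n k θ (c' - ε) v u')} ⊆
      Subtype.val '' {v : S | v ∈ levelVertices S n k c ∧
        (ε < c → SameComponent kind S n k θ (c - ε) v u)} := by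
    intro c c' u u' hcc h1 h2
    refine Set.image_mono fun v hv => ⟨levelVertices_anti hcc hv.1, fun hc => ?_⟩
    have h3 := (hv.2 (hc.trans_le hcc)).trans (h2 (hc.trans_le hcc)).symm
    exact (h3.anti (by linarith)).trans (h1 hc)
  rcases le_total c c' with hcc | hcc
  · exact Or.inr (key hcc hpu hpu')
  · exact Or.inl (key hcc hpu' hpu)

/-- A smallest cluster exists as soon as there is a cluster. -/
theorem exists_isSmallestCluster {ε : ℝ} (hε : 0 ≤ ε) (hS : S.Finite)
    {A D : Set (EuclideanSpace ℝ (Fin d))} (hA : (A ∩ S).Nonempty)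
    (hD : D ∈ clusters kind S n k θ ε) (hAD : A ∩ S ⊆ D) :
    ∃ D', IsSmallestCluster kind S n k θ ε A D' := by
  have hfin : {D | D ∈ clusters kind S n k θ ε ∧ A ∩ S ⊆ D}.Finite := by
    refine hS.finite_subsets.subset ?_
    rintro D ⟨hD, -⟩
    rw [mem_clusters_iff hε] at hD
    obtain ⟨c, -, u, -, rfl⟩ := hD
    rintro _ ⟨v, -, rfl⟩
    exact v.2
  -- Candidates share a sample point of `A`, hence are nested; so a minimal one is least.
  obtain ⟨D', hD'⟩ := hfin.exists_minimal ⟨D, hD, hAD⟩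
  refine ⟨D', hD'.1, fun D₁ hD₁ => ?_⟩
  obtain ⟨a, ha⟩ := hA
  rcases clusters_laminar hε hD'.1.1 hD₁.1 ⟨a, hD'.1.2 ha, hD₁.2 ha⟩ with h | h
  · exact h
  · exact hD'.2 hD₁ h

/-- Sample points in a preconnected set around which the sample is dense at a scale that is small
compared with the `k`-NN radii are in the same component. -/
theorem sameComponent_of_isPreconnected {A : Set (EuclideanSpace ℝ (Fin d))}
    (hA : IsPreconnected A) {c r s : ℝ} (hr : 0 < r) (hθ : 0 ≤ θ) (hrs : 3 * r ≤ θ * s)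
    (hcov : ∀ a ∈ A, ∃ y ∈ S, dist y a ≤ r)
    (hlev : ∀ y : S, ∀ a ∈ A, dist y.1 a ≤ r → y ∈ levelVertices S n k c)
    (hrad : ∀ y : S, ∀ a ∈ A, dist y.1 a ≤ r → s ≤ kNNRadius S k y.1)
    {u v : S} (hu : u.1 ∈ A) (hv : v.1 ∈ A) : SameComponent kind S n k θ c u v := by
  have key : ∀ y z : S, dist y.1 u.1 ≤ r → dist z.1 v.1 ≤ r →
      SameComponent kind S n k θ c y z := by
    -- The relation "all sample points near `a` are joined to all those near `b`" is symmetric,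
    -- transitive because some sample point is near the middle point, and true locally: then `y` and
    -- `z` are at distance at most `3 * r`. Preconnectedness makes it global.
    refine hA.induction₂ (fun a b => ∀ y z : S, dist y.1 a ≤ r → dist z.1 b ≤ r →
      SameComponent kind S n k θ c y z) ?_ ?_ ?_ hu hv
    · intro a ha
      filter_upwards [mem_nhdsWithin_of_mem_nhds (Metric.closedBall_mem_nhds a hr),
        self_mem_nhdsWithin] with b hab hb y z hy hz
      have hyz : dist y.1 z.1 ≤ θ * s := by
        have h1 := dist_triangle4 y.1 a b z.1
        have h2 : dist a b ≤ r := by rw [dist_comm]; exact hab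
        have h3 : dist b z.1 ≤ r := by rw [dist_comm]; exact hz
        linarith
      by_cases hne : y = z
      · rw [hne]; exact SameComponent.refl (hlev z b hb hz)
      · refine SameComponent.of_adj (hlev y a ha hy) (hlev z b hb hz)
          (sampleGraph_adj_of_dist_le hne (hyz.trans ?_) (hyz.trans ?_))
        · exact mul_le_mul_of_nonneg_left (hrad y a ha hy) hθ
        · exact mul_le_mul_of_nonneg_left (hrad z b hb hz) hθ
    · intro a b e _ hb _ hab hbe y z hy hz
      obtain ⟨w, hw, hwb⟩ := hcov b hb
      exact (hab y ⟨w, hw⟩ hy hwb).trans (hbe ⟨w, hw⟩ z hwb hz)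
    · intro a b _ _ hab y z hy hz
      exact (hab z y hz hy).symm
  exact key u v (by simpa using hr.le) (by simpa using hr.le)

/-- The consistency of the pruned tree for a sample with regular `k`-NN radii. -/
theorem cluster_separation {f : EuclideanSpace ℝ (Fin d) → ℝ} (hd : 0 < d) (hS : S.Finite)
    (hn : 0 < n) {ε lam η δ : ℝ} (hε : 0 ≤ ε) (hη : 0 < η) (hηlam : η < lam)
    (hsep : ∀ x x', lam ≤ f x → lam ≤ f x' →
      connectedComponentIn {y | lam ≤ f y} x ≠ connectedComponentIn {y | lam ≤ f y} x' →
      connectedComponentIn {y | lam - η ≤ f y} x ≠ connectedComponentIn {y | lam - η ≤ f y} x')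
    (hδ : ∀ x ∈ {y | lam - η ≤ f y}, ∀ y ∈ {y | lam - η ≤ f y}, dist x y < δ →
      connectedComponentIn {y | lam - η ≤ f y} x = connectedComponentIn {y | lam - η ≤ f y} y)
    (hεη : ε < η / 3) (hθ : 0 < θ) {r₁ r₂ r₃ r₄ : ℝ}
    (hr₁ : 0 < r₁) (hr₂ : 0 < r₂) (hr₃ : 0 < r₃) (hr₄ : 0 < r₄)
    (he₁ : n * unitVolume d * r₁ ^ d * (lam - η / 3) = k)
    (he₂ : n * unitVolume d * r₂ ^ d * (lam - 2 * η / 3) = k)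
    (hr₄₃ : 3 * r₄ ≤ θ * r₃) (hr₂δ : θ * r₂ < δ)
    (hosc : ∀ x, ∀ y ∈ Metric.closedBall x r₄, |f y - f x| ≤ η / 6)
    (h₁ : ∀ x ∈ S, lam - η / 6 ≤ f x → k ≤ (Metric.closedBall x r₁ ∩ (S \ {x})).ncard)
    (h₂ : ∀ x ∈ S, f x ≤ lam - η → (Metric.closedBall x r₂ ∩ (S \ {x})).ncard < k)
    (h₃ : ∀ x ∈ S, (Metric.closedBall x r₃ ∩ (S \ {x})).ncard < k)
    (h₄ : ∀ x, lam ≤ f x → ∃ y ∈ S, dist y x ≤ r₄) :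
    (∀ A ∈ clusterTree f lam, (A ∩ S).Nonempty → ∃ D, IsSmallestCluster kind S n k θ ε A D) ∧
    (∀ A ∈ clusterTree f lam, ∀ A' ∈ clusterTree f lam, A ≠ A' →
      (A ∩ S).Nonempty → (A' ∩ S).Nonempty →
      ∀ D D', IsSmallestCluster kind S n k θ ε A D →
        IsSmallestCluster kind S n k θ ε A' D' → Disjoint D D') := by
  have hmain : ∀ x, lam ≤ f x → (connectedComponentIn {y | lam ≤ f y} x ∩ S).Nonempty →
      ∃ D ∈ clusters kind S n k θ ε, connectedComponentIn {y | lam ≤ f y} x ∩ S ⊆ D ∧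
        ∀ z ∈ D, connectedComponentIn {y | lam - η ≤ f y} z =
          connectedComponentIn {y | lam - η ≤ f y} x := by
    rintro x hx ⟨u, huA, huS⟩
    have hnear : ∀ y : S, ∀ a ∈ connectedComponentIn {y | lam ≤ f y} x, dist y.1 a ≤ r₄ →
        lam - η / 6 ≤ f y.1 := by
      intro y a ha hy
      have h : a ∈ {y | lam ≤ f y} := connectedComponentIn_subset _ _ ha
      rw [Set.mem_ofPred_eq] at h
      linarith [(abs_le.1 (hosc a y.1 hy)).1]
    have hrad : ∀ y : S, lam - η / 6 ≤ f y.1 → r₃ ≤ kNNRadius S k y.1 := fun y hy =>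
      le_kNNRadius hS (h₃ y.1 y.2) hr₁.le (h₁ y.1 y.2 hy)
    have hlev : ∀ y : S, lam - η / 6 ≤ f y.1 → y ∈ levelVertices S n k (lam - η / 3) :=
      fun y hy => le_densityEstimate he₁ hn (by linarith) (hr₃.trans_le (hrad y hy))
        (kNNRadius_le hr₁.le (h₁ y.1 y.2 hy))
    have hconn : ∀ v : S, v.1 ∈ connectedComponentIn {y | lam ≤ f y} x →
        SameComponent kind S n k θ (lam - η / 3) v ⟨u, huS⟩ := fun v hv =>
      sameComponent_of_isPreconnected isPreconnected_connectedComponentIn hr₄ hθ.le hr₄₃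
        (fun a ha => h₄ a (connectedComponentIn_subset {y | lam ≤ f y} x ha))
        (fun y a ha hy => hlev y (hnear y a ha hy)) (fun y a ha hy => hrad y (hnear y a ha hy))
        hv huA
    have hsub : {y | lam ≤ f y} ⊆ {y | lam - η ≤ f y} := fun y (hy : lam ≤ f y) =>
      show lam - η ≤ f y by linarith
    have hεlam : ε < lam - η / 3 := by linarith
    -- As `ε < η / 3`, the level stays above `lam - 2 * η / 3`; this excludes points with `f < lam -
    -- η` and bounds the edge lengths by `δ`.
    have hpos : ∀ v ∈ levelVertices S n k (lam - η / 3 - ε),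
        lam - η ≤ f v.1 ∧ θ * kNNRadius S k v.1 < δ := by
      intro v hv
      have hv' : lam - 2 * η / 3 < densityEstimate S n k v.1 :=
        lt_of_lt_of_le (by linarith) hv
      constructor
      · by_contra! hcon
        exact absurd hv' (densityEstimate_le_of_ncard_lt hd hS he₂ hr₂ hn (by linarith)
          (h₂ v.1 v.2 hcon.le)).not_gt
      · exact (mul_lt_mul_of_pos_left (kNNRadius_le_of_lt_densityEstimate he₂ hr₂ hn
          (by linarith) hv') hθ).trans hr₂δ
    refine ⟨_, (mem_clusters_iff hε _).2 ⟨lam - η / 3, by linarith, ⟨u, huS⟩,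
      (hconn ⟨u, huS⟩ huA).1, rfl⟩, ?_, ?_⟩
    · rintro v ⟨hvA, hvS⟩
      exact ⟨⟨v, hvS⟩, ⟨(hconn ⟨v, hvS⟩ hvA).1, fun _ =>
        (hconn ⟨v, hvS⟩ hvA).anti (by linarith)⟩, rfl⟩
    · rintro _ ⟨v, ⟨_, hv⟩, rfl⟩
      -- Edges shorter than `δ` cannot leave a component of `{f ≥ lam - η}`.
      have h1 := (hv hεlam).eq_of_adj
        (fun w : S => connectedComponentIn {y | lam - η ≤ f y} w.1) fun a ha b hb hab =>
          hδ a.1 (hpos a ha).1 b.1 (hpos b hb).1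
            (dist_lt_of_sampleGraph_adj hab (hpos a ha).2 (hpos b hb).2)
      exact h1.trans (connectedComponentIn_eq (connectedComponentIn_mono x hsub huA)).symm
  refine ⟨?_, ?_⟩
  · rintro _ ⟨x, hx, rfl⟩ hne
    obtain ⟨D, hD, hAD, -⟩ := hmain x hx hne
    exact exists_isSmallestCluster hε hS hne hD hAD
  · rintro _ ⟨x, hx, rfl⟩ _ ⟨x', hx', rfl⟩ hAA hne hne' D D' hD hD'
    obtain ⟨D₀, h1, h2, h3⟩ := hmain x hx hne
    obtain ⟨D₀', h1', h2', h3'⟩ := hmain x' hx' hne'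
    rw [Set.disjoint_left]
    intro z hz hz'
    -- The smallest clusters lie in `D₀` and `D₀'`; a common point would identify the two components
    -- at level `lam - η`.
    exact hsep x x' hx hx' hAA
      ((h3 z (hD.2 ⟨h1, h2⟩ hz)).symm.trans (h3' z (hD'.2 ⟨h1', h2'⟩ hz')))

end Graph

/-! ### The scale of the radii -/

/-- The upper bound on `k` is a power of `n` with exponent below 1, up to a power of the logarithm.
-/
theorem tendsto_div_of_inRange {d : ℕ} (hd : 0 < d) {C C' F α θ δ : ℝ} (hF : 0 < F) (hα : 0 < α)
    (hδ : 0 < δ) {k : ℕ → ℕ} (hk : ∀ᶠ n in atTop, InRange d C C' F α θ δ n (k n)) :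
    Tendsto (fun n : ℕ => (k n : ℝ) / n) atTop (𝓝 0) := by
  have hd' : (0 : ℝ) < d := by exact_mod_cast hd
  set a := 2 * α / (3 * α + d) with ha
  set p := 2 * (α + d) / (3 * α + d) with hp
  have ha1 : 0 < 1 - a := by
    rw [ha, sub_pos, div_lt_one (by positivity)]
    linarith
  have hx : Tendsto (fun n : ℕ => (n : ℝ) / δ) atTop atTop :=
    tendsto_natCast_atTop_atTop.atTop_div_const hδ
  -- The comparison is made at `n / δ`, the argument of the logarithm; the factor `δ ^ (a - 1)`
  -- compensates.
  have h0 := ((isLittleO_log_rpow_rpow_atTop (p / 2) ha1).tendsto_div_nhds_zero.comp hx).const_mul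
    (C' * F ^ p * δ ^ (a - 1))
  rw [mul_zero] at h0
  refine squeeze_zero' (Eventually.of_forall fun n => by positivity) ?_ h0
  filter_upwards [hk, hx.eventually_gt_atTop 1, eventually_gt_atTop 0] with n h1 h2 h3
  have hn : (0 : ℝ) < n := by exact_mod_cast h3
  have hlog : 0 ≤ Real.log (n / δ) := Real.log_nonneg h2.le
  rw [div_le_iff₀ hn]
  refine h1.2.trans (le_of_eq ?_)
  have e1 : √(Real.log (n / δ)) ^ p = Real.log (n / δ) ^ (p / 2) := by
    rw [Real.sqrt_eq_rpow, ← Real.rpow_mul hlog]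
    congr 1
    ring
  have e2 : (n : ℝ) ^ a = δ ^ (a - 1) / (n / δ) ^ (1 - a) * n := by
    rw [Real.div_rpow hn.le hδ.le, div_div_eq_mul_div, ← Real.rpow_add hδ,
      show a - 1 + (1 - a) = 0 by ring, Real.rpow_zero, one_div, ← Real.rpow_neg hn.le]
    nth_rewrite 3 [← Real.rpow_one (n : ℝ)]
    rw [← Real.rpow_add hn]
    congr 1
    ring
  rw [← hp, ← ha, Real.mul_rpow hF.le (Real.sqrt_nonneg _), e1, e2]
  simp only [Function.comp_apply]
  ring

/-- The radius of a ball of which the volume is such that `q` is the density estimate for `k`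
points out of `n`. -/
noncomputable def levelRadius (d n k : ℕ) (q : ℝ) : ℝ := (k / (n * unitVolume d * q)) ^ (d : ℝ)⁻¹

section LevelRadius

variable {d : ℕ} {q : ℝ}

theorem levelRadius_pos {n k : ℕ} (hn : 0 < n) (hk : 0 < k) (hq : 0 < q) :
    0 < levelRadius d n k q := by
  have hv := unitVolume_pos d
  have hn' : (0 : ℝ) < n := by exact_mod_cast hn
  have hk' : (0 : ℝ) < k := by exact_mod_cast hk
  exact Real.rpow_pos_of_pos (by positivity) _

theorem levelRadius_pow (hd : 0 < d) {n k : ℕ} (hn : 0 < n) (hq : 0 < q) :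
    n * unitVolume d * levelRadius d n k q ^ d * q = k := by
  have hv := unitVolume_pos d
  have hn' : (0 : ℝ) < n := by exact_mod_cast hn
  rw [levelRadius, Real.rpow_inv_natCast_pow (by positivity) hd.ne']
  field_simp

theorem tendsto_levelRadius (hd : 0 < d) {k : ℕ → ℕ}
    (hk : Tendsto (fun n : ℕ => (k n : ℝ) / n) atTop (𝓝 0)) :
    Tendsto (fun n => levelRadius d n (k n) q) atTop (𝓝 0) := by
  have hd' : (0 : ℝ) < d := by exact_mod_cast hd
  have h1 : Tendsto (fun n : ℕ => (k n : ℝ) / (n * unitVolume d * q)) atTop (𝓝 0) := by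
    have := hk.div_const (unitVolume d * q)
    rw [zero_div] at this
    exact this.congr fun n => by rw [div_div, mul_assoc]
  have h2 := h1.rpow_const (p := (d : ℝ)⁻¹) (Or.inr (by positivity))
  rwa [Real.zero_rpow (by positivity)] at h2

end LevelRadius

/-! ### Sample points, indices and ties -/

section Sample

variable {Ω : Type*} {d : ℕ} {X : ℕ → Ω → EuclideanSpace ℝ (Fin d)} {n : ℕ} {ω : Ω}

theorem finite_sample : (sample X n ω).Finite := Set.finite_range _

theorem inter_sample_eq_image (B : Set (EuclideanSpace ℝ (Fin d))) :
    B ∩ sample X n ω = (fun i => X i ω) '' {i | i < n ∧ X i ω ∈ B} := by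
  ext x
  constructor
  · rintro ⟨hx, i, rfl⟩
    exact ⟨i, ⟨i.2, hx⟩, rfl⟩
  · rintro ⟨i, ⟨hi, hB⟩, rfl⟩
    exact ⟨hB, ⟨i, hi⟩, rfl⟩

theorem ncard_inter_diff_le_hits (B : Set (EuclideanSpace ℝ (Fin d)))
    (x : EuclideanSpace ℝ (Fin d)) : (B ∩ (sample X n ω \ {x})).ncard ≤ hits X n B ω := by
  refine (Set.ncard_le_ncard (Set.inter_subset_inter_right B Set.sdiff_subset)
    (finite_sample.subset Set.inter_subset_right)).trans ?_
  rw [inter_sample_eq_image]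
  exact Set.ncard_image_le ((Set.finite_Iio n).subset fun _ hi => hi.1)

/-- Without ties, indices correspond to points, and deleting the center loses at most one of them.
-/
theorem hits_le_ncard_inter_diff (hinj : ∀ i j, i ≠ j → X i ω ≠ X j ω)
    (B : Set (EuclideanSpace ℝ (Fin d))) (x : EuclideanSpace ℝ (Fin d)) :
    hits X n B ω ≤ (B ∩ (sample X n ω \ {x})).ncard + 1 := by
  have h1 : hits X n B ω = (B ∩ sample X n ω).ncard := by
    rw [inter_sample_eq_image, Set.ncard_image_of_injective]
    · rfl
    · intro i j hij
      by_contra hne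
      exact hinj i j hne hij
  rw [h1]
  refine (Set.ncard_le_ncard (t := insert x (B ∩ (sample X n ω \ {x}))) ?_
    ((finite_sample.subset (Set.inter_subset_right.trans Set.sdiff_subset)).insert x)).trans
    (Set.ncard_insert_le _ _)
  intro y hy
  by_cases h : y = x
  · exact Or.inl h
  · exact Or.inr ⟨hy.1, hy.2, h⟩

theorem exists_mem_sample_of_hits_pos {B : Set (EuclideanSpace ℝ (Fin d))}
    (h : 0 < hits X n B ω) : ∃ y ∈ sample X n ω, y ∈ B := by
  obtain ⟨i, hi, hB⟩ := Set.nonempty_of_ncard_ne_zero h.ne'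
  exact ⟨X i ω, ⟨⟨i, hi⟩, rfl⟩, hB⟩

end Sample

section Law

variable {Ω : Type*} [MeasurableSpace Ω] {P : Measure Ω} {d : ℕ}
  {f : EuclideanSpace ℝ (Fin d) → ℝ} {X : ℕ → Ω → EuclideanSpace ℝ (Fin d)}

theorem ae_mem_of_law (hX : ∀ i, Measurable (X i)) (hlaw : ∀ i, P.map (X i) = distribution f)
    {K : Set (EuclideanSpace ℝ (Fin d))} (hK : MeasurableSet K) (h0 : distribution f Kᶜ = 0) :
    ∀ᵐ ω ∂P, ∀ i, X i ω ∈ K := by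
  rw [ae_all_iff]
  intro i
  rw [← hlaw i, Measure.map_apply (hX i) hK.compl] at h0
  exact h0

/-- By independence the joint law of two sample points is a product; Fubini makes the diagonal null,
as the law has no atoms for `d > 0`. -/
theorem ae_injective_of_law [IsProbabilityMeasure P] (hd : 0 < d) (hX : ∀ i, Measurable (X i)) (hindep : iIndepFun X P)
    (hlaw : ∀ i, P.map (X i) = distribution f) :
    ∀ᵐ ω ∂P, ∀ i j, i ≠ j → X i ω ≠ X j ω := by
  have : IsProbabilityMeasure (distribution f) := by
    rw [← hlaw 0]; exact Measure.isProbabilityMeasure_map (hX 0).aemeasurable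
  have : Nonempty (Fin d) := ⟨⟨0, hd⟩⟩
  simp only [ae_all_iff]
  intro i j hij
  have hdiag : MeasurableSet {p : EuclideanSpace ℝ (Fin d) × EuclideanSpace ℝ (Fin d) |
      p.1 = p.2} := measurableSet_eq_fun measurable_fst measurable_snd
  have hprod := (indepFun_iff_map_prod_eq_prod_map_map (hX i).aemeasurable
    (hX j).aemeasurable).1 (hindep.indepFun hij)
  have h0 : (P.map fun ω => (X i ω, X j ω)) {p | p.1 = p.2} = 0 := by
    rw [hprod, hlaw i, hlaw j, Measure.measure_prod_null hdiag]
    refine ae_of_all _ fun x => ?_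
    have hac : distribution f ≪ volume := withDensity_absolutelyContinuous _ _
    have : Prod.mk x ⁻¹' {p : EuclideanSpace ℝ (Fin d) × EuclideanSpace ℝ (Fin d) |
        p.1 = p.2} = {x} := by
      ext y; simp [eq_comm]
    change distribution f (Prod.mk x ⁻¹' _) = 0
    rw [this]
    exact hac (measure_singleton x)
  rw [Measure.map_apply ((hX i).prodMk (hX j)) hdiag] at h0
  rw [ae_iff]
  simpa using h0

end Law

end KNNTree

/-! ### The main theorem -/

theorem corollary1 {Ω : Type*} [MeasurableSpace Ω] (P : Measure Ω) [IsProbabilityMeasure P]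
    {d : ℕ} (hd : 0 < d)
    -- the density, bounded and Hölder continuous
    (f : EuclideanSpace ℝ (Fin d) → ℝ) (hf : ∀ x, 0 ≤ f x)
    (F : ℝ) (hF : 0 < F) (hfF : ∀ x, f x ≤ F)
    (L α : ℝ) (hL : 0 < L) (hα : 0 < α) (hfα : ∀ x x', |f x - f x'| ≤ L * ‖x - x'‖ ^ α)
    -- compact support, and finitely many components at every level
    (hsupp : ∃ K : Set (EuclideanSpace ℝ (Fin d)), IsCompact K ∧ KNNTree.distribution f Kᶜ = 0)
    (hfin : ∀ μ : ℝ, 0 < μ → (KNNTree.clusterTree f μ).Finite)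
    -- the i.i.d. sample
    (X : ℕ → Ω → EuclideanSpace ℝ (Fin d)) (hX : ∀ i, Measurable (X i))
    (hindep : iIndepFun X P) (hlaw : ∀ i, P.map (X i) = KNNTree.distribution f)
    -- the graph and the parameters
    (kind : KNNTree.GraphKind) (θ : ℝ) (hθ : 0 < θ)
    (ε : ℕ → ℝ) (hε : ∀ n, 0 ≤ ε n) (hε_lim : Tendsto ε atTop (𝓝 0))
    (k : ℕ → ℕ) (hk_lim : Tendsto (fun n : ℕ => (k n : ℝ) / Real.log n) atTop atTop)
    (C C' δ : ℝ) (hC : 0 < C) (hC' : 0 < C') (hδ : 0 < δ)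
    (hk : ∀ᶠ n in atTop, KNNTree.InRange d C C' F α θ δ n (k n))
    (lam : ℝ) (hlam : 0 < lam) :
    Tendsto
      (fun n => P {ω |
        -- every component that contains sample points has a smallest empirical cluster
        (∀ A ∈ KNNTree.clusterTree f lam, (A ∩ KNNTree.sample X n ω).Nonempty →
          ∃ D, KNNTree.IsSmallestCluster kind (KNNTree.sample X n ω) n (k n) θ (ε n) A D) ∧
        -- and these clusters are disjoint for distinct components
        (∀ A ∈ KNNTree.clusterTree f lam, ∀ A' ∈ KNNTree.clusterTree f lam, A ≠ A' →
          (A ∩ KNNTree.sample X n ω).Nonempty → (A' ∩ KNNTree.sample X n ω).Nonempty →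
          ∀ D D', KNNTree.IsSmallestCluster kind (KNNTree.sample X n ω) n (k n) θ (ε n) A D →
            KNNTree.IsSmallestCluster kind (KNNTree.sample X n ω) n (k n) θ (ε n) A' D' →
            Disjoint D D')})
      atTop (𝓝 1) := by
  obtain ⟨K, hK, hK0⟩ := hsupp
  have hfc : Continuous f := KNNTree.continuous_of_holder hα hfα
  have hfK := KNNTree.nonpos_of_notMem_support hfc hK.isClosed hK0
  obtain ⟨R, hR, hKR⟩ : ∃ R : ℝ, 0 ≤ R ∧ ∀ x ∈ K, ‖x‖ ≤ R := by
    obtain ⟨R, hR⟩ := hK.isBounded.exists_norm_le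
    exact ⟨max R 0, le_max_right _ _, fun x hx => (hR x hx).trans (le_max_left _ _)⟩
  have hlevK : ∀ {c : ℝ}, 0 < c → ∀ x, c ≤ f x → x ∈ K := by
    intro c hc x hx
    by_contra h
    linarith [hfK x h]
  obtain ⟨η, hη, hηlam, hsep⟩ := KNNTree.exists_level_separation hfc hK hfK hlam (hfin lam hlam)
  obtain ⟨δ₀, hδ₀, hδsep⟩ := KNNTree.exists_component_separation
    (KNNTree.isCompact_level hfc hK hfK (sub_pos.2 hηlam)) (hfin _ (sub_pos.2 hηlam))
  have hkn := KNNTree.tendsto_div_of_inRange hd hF hα hδ hk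
  have hkpos := KNNTree.eventually_pos_of_tendsto_div_log hk_lim
  let r : ℝ → ℕ → ℝ := fun q n => KNNTree.levelRadius d n (k n) q
  have hr0 : ∀ {q : ℝ}, 0 < q → ∀ᶠ n in atTop, 0 < r q n := fun hq => by
    filter_upwards [hkpos, eventually_gt_atTop 0] with n h1 h2
    exact KNNTree.levelRadius_pos h2 h1 hq
  have hrlim : ∀ q : ℝ, Tendsto (r q) atTop (𝓝 0) := fun q => KNNTree.tendsto_levelRadius hd hkn
  have hrk : ∀ {q : ℝ}, 0 < q →
      ∀ᶠ n : ℕ in atTop, n * KNNTree.unitVolume d * r q n ^ d * q = k n := fun hq => by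
    filter_upwards [eventually_gt_atTop 0] with n h2
    exact KNNTree.levelRadius_pow hd h2 hq
  have hq₁ : 0 < lam - η / 3 := by linarith
  have hq₂ : 0 < lam - 2 * η / 3 := by linarith
  -- At the radius for `2 * F` the expected count is at most `k / 2`, because `f ≤ F`.
  have hq₃ : 0 < 2 * F := by linarith
  have hr4 : ∀ᶠ n in atTop, 0 < θ / 3 * r (2 * F) n := by
    filter_upwards [hr0 hq₃] with n hn
    positivity
  have hr4lim : Tendsto (fun n => θ / 3 * r (2 * F) n) atTop (𝓝 0) := by
    simpa using (hrlim (2 * F)).const_mul (θ / 3)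
  -- The covering radius solves the same equation with another `q`, so the same concentration lemma
  -- applies; its factor `1 / 3` matches the chain of three distances.
  have hr4k : ∀ᶠ n : ℕ in atTop, n * KNNTree.unitVolume d * (θ / 3 * r (2 * F) n) ^ d *
      (2 * F * (3 / θ) ^ d) = k n := by
    filter_upwards [hrk hq₃] with n hn
    rw [← hn, mul_pow, div_pow, div_pow]
    field_simp
  -- The four bad events. In each, a level strictly between that of `f` and that of the radius
  -- leaves room for concentration; in `hB₄`, `β = 0` means that a ball is empty.
  have hB₁ := KNNTree.tendsto_measure_hits_le (P := P) (E := {x | lam - η / 6 ≤ f x}) (β := 1)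
    hk_lim hα hL hfα hfc.measurable hX hindep hlaw hR
    (fun x hx => hKR x (hlevK (by linarith) x hx)) hq₁ (hr0 hq₁) (hrlim _) (hrk hq₁)
    (m := lam - η / 6) (fun x hx => hx) zero_le_one (by linarith)
  have hB₂ := KNNTree.tendsto_measure_le_hits (P := P) (E := {x | x ∈ K ∧ f x ≤ lam - η}) (β := 1)
    hk_lim hα hL hfα hX hindep hlaw hR
    (fun x hx => hKR x hx.1) hq₂ (hr0 hq₂) (hrlim _) (hrk hq₂)
    (m := lam - η) (by linarith) (fun x hx => hx.2) (by linarith)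
  have hB₃ := KNNTree.tendsto_measure_le_hits (P := P) (E := K) (β := 1)
    hk_lim hα hL hfα hX hindep hlaw hR hKR hq₃ (hr0 hq₃) (hrlim _) (hrk hq₃)
    (m := F) hF.le (fun x _ => hfF x) (by linarith)
  have hB₄ := KNNTree.tendsto_measure_hits_le (P := P) (E := {x | lam ≤ f x}) (β := 0)
    hk_lim hα hL hfα hfc.measurable hX hindep hlaw hR
    (fun x hx => hKR x (hlevK hlam x hx)) (by positivity) hr4 hr4lim hr4k
    (m := lam) (fun x hx => hx) le_rfl (by linarith)
  have hN : P {ω | ¬ ((∀ i, X i ω ∈ K) ∧ ∀ i j, i ≠ j → X i ω ≠ X j ω)} = 0 :=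
    ae_iff.1 ((KNNTree.ae_mem_of_law hX hlaw hK.measurableSet hK0).and
      (KNNTree.ae_injective_of_law hd hX hindep hlaw))
  have hlow := ENNReal.Tendsto.sub (tendsto_const_nhds (x := (1 : ENNReal)))
    (((hB₁.add hB₂).add hB₃).add hB₄) (Or.inl ENNReal.one_ne_top)
  simp only [add_zero, tsub_zero] at hlow
  refine tendsto_of_tendsto_of_tendsto_of_le_of_le' hlow tendsto_const_nhds ?_
    (Eventually.of_forall fun n => prob_le_one)
  filter_upwards [hr0 hq₁, hr0 hq₂, hr0 hq₃, hr4, hrk hq₁, hrk hq₂, eventually_gt_atTop 0,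
    hε_lim.eventually_lt_const (show 0 < η / 3 by linarith),
    KNNTree.eventually_oscillation_le hα hfα hL hr4lim (a := 1) (show 0 < η / 6 by linarith),
    (show Tendsto (fun n => θ * r (lam - 2 * η / 3) n) atTop (𝓝 0) by
      simpa using (hrlim _).const_mul θ).eventually_lt_const hδ₀]
    with n p₁ p₂ p₃ p₄ e₁ e₂ hn hεn hosc hedge
  rw [tsub_le_iff_right, ← measure_univ (μ := P)]
  refine (measure_mono (t := _ ∪ ((((_ ∪ _) ∪ _) ∪ _) ∪ _)) ?_).trans
    ((measure_union_le _ _).trans (add_le_add le_rfl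
      ((measure_union_le _ _).trans (((add_le_add ((measure_union_le _ _).trans (add_le_add
        ((measure_union_le _ _).trans (add_le_add (measure_union_le _ _) le_rfl)) le_rfl))
          hN.le)).trans (add_zero _).le))))
  intro ω _
  by_cases hbad : ω ∈ (({ω | ∃ x ∈ {x | lam - η / 6 ≤ f x}, (KNNTree.hits X n
      (Metric.closedBall x (r (lam - η / 3) n)) ω : ℝ) ≤ 1 * k n} ∪
      {ω | ∃ x ∈ {x | x ∈ K ∧ f x ≤ lam - η}, 1 * (k n : ℝ) ≤ KNNTree.hits X n
      (Metric.closedBall x (r (lam - 2 * η / 3) n)) ω}) ∪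
      {ω | ∃ x ∈ K, 1 * (k n : ℝ) ≤ KNNTree.hits X n
      (Metric.closedBall x (r (2 * F) n)) ω}) ∪
      {ω | ∃ x ∈ {x | lam ≤ f x}, (KNNTree.hits X n
      (Metric.closedBall x (θ / 3 * r (2 * F) n)) ω : ℝ) ≤ 0 * k n} ∪
      {ω | ¬ ((∀ i, X i ω ∈ K) ∧ ∀ i j, i ≠ j → X i ω ≠ X j ω)}
  · exact Or.inr hbad
  left
  simp only [Set.mem_union, Set.mem_ofPred_eq, not_or, not_exists, not_and, not_le,
    one_mul, zero_mul] at hbad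
  obtain ⟨⟨⟨⟨b₁, b₂⟩, b₃⟩, b₄⟩, b₅⟩ := hbad
  obtain ⟨hωK, hinj⟩ : (∀ i, X i ω ∈ K) ∧ ∀ i j, i ≠ j → X i ω ≠ X j ω :=
    by_contra fun h => b₅ fun h₁ h₂ => h ⟨h₁, h₂⟩
  have hSK : ∀ x ∈ KNNTree.sample X n ω, x ∈ K := by
    rintro _ ⟨i, rfl⟩
    exact hωK i
  refine KNNTree.cluster_separation hd KNNTree.finite_sample hn (hε n) hη hηlam hsep hδsep hεn hθ
    p₁ p₂ p₃ p₄ e₁ e₂ (by linarith) hedge (by simpa using hosc) ?_ ?_ ?_ ?_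
  · intro x _ hx
    -- The strict inequality makes up for the deleted center.
    have h1 : k n < KNNTree.hits X n (Metric.closedBall x (r (lam - η / 3) n)) ω := by
      exact_mod_cast b₁ x hx
    have h2 := KNNTree.hits_le_ncard_inter_diff (n := n) hinj
      (Metric.closedBall x (r (lam - η / 3) n)) x
    omega
  · intro x hx hfx
    refine (KNNTree.ncard_inter_diff_le_hits _ _).trans_lt ?_
    exact_mod_cast b₂ x ⟨hSK x hx, hfx⟩
  · intro x hx
    refine (KNNTree.ncard_inter_diff_le_hits _ _).trans_lt ?_
    exact_mod_cast b₃ x (hSK x hx)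
  · intro x hx
    exact KNNTree.exists_mem_sample_of_hits_pos (by exact_mod_cast b₄ x hx)
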